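/- Let $\Sigma=\{0,\dots,q-1\}$ be a finite alphabet of size $q\ge 1$ (for instance $q=2$), and let $L_{REV}=\{uu^rvv^r : u,v\in\Sigma^*,\ u,v \text{ non-empty}\}$, where $u^r$ is the reverse of $u$. For a positive integer $n$ let $\mathrm{REV}_n:\Sigma^n\to\{0,1\}$ be the function with $\mathrm{REV}_n(x)=1$ if and only if $x\in L_{REV}$. **Theorem.** 1. (Classical.) There is a deterministic classical algorithm (a single program for a unit-cost random access machine with $O(\log n)$-bit words, which receives $n$ and reads a symbol $x_i$ of the input by a query) that, for every $n\ge 1$ and every $x\in\Sigma^n$, outputs $\mathrm{REV}_n(x)$ within time $O(n)$ and with $O(n)$ queries. 2. (Quantum.) There are constants $C$ and $\varepsilon<\tfrac12$ such that for every $n\ge 1$ there is a quantum query algorithm that makes at most $C\sqrt n\,(\log n)^2$ queries and, on every input $x\in\Sigma^n$, outputs the wrong value of $\mathrm{REV}_n(x)$ with probability at most $\varepsilon$ (two-sided error). Here a quantum query algorithm alternates arbitrary input-independent unitaries with the query transformation $|i\rangle|z\rangle|w\rangle\mapsto|i\rangle|z+x_i \bmod q\rangle|w\rangle$, where $w$ ranges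 over a finite work-space, starting from a fixed basis state, and ends with a measurement in the computational basis. -/

import Mathlib

/-! ### The language of concatenations of two palindromes -/

/-- The language `L_REV` of all words `u uʳ v vʳ` with `u` and `v` non-empty words over `α`. -/
def LREV (α : Type*) : Set (List α) :=
  {w | ∃ u v : List α, u ≠ [] ∧ v ≠ [] ∧ w = u ++ u.reverse ++ v ++ v.reverse}

open Classical in
/-- The Boolean function `REV_n : αⁿ → {0, 1}`, with `REV_n x = 1` iff `x ∈ L_REV`. -/
noncomputable def REV {α : Type*} {n : ℕ} (x : Fin n → α) : Bool :=
  decide (List.ofFn x ∈ LREV α)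

/-! ### Classical algorithms: random access machines with query access to the input -/

namespace RAM

/-- The instructions of a random access machine with registers `X₀, X₁, X₂, …` that hold
natural numbers. Every instruction takes one unit of time. -/
inductive Instr : Type
  /-- `Xᵢ ← c` -/
  | const (i c : ℕ)
  /-- `Xᵢ ← Xⱼ + Xₖ` -/
  | add (i j k : ℕ)
  /-- `Xᵢ ← max (Xⱼ - Xₖ) 0` -/
  | sub (i j k : ℕ)
  /-- `Xᵢ ← X_a` where `a = Xⱼ` (indirect load) -/
  | load (i j : ℕ)
  /-- `X_a ← Xⱼ` where `a = Xᵢ` (indirect store) -/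
  | store (i j : ℕ)
  /-- `Xᵢ ← x_a` where `a = Xⱼ`: one query to the input -/
  | query (i j : ℕ)
  /-- if `Xⱼ > 0` continue with instruction number `m` -/
  | jumpPos (j m : ℕ)
  /-- halt with the answer `b` -/
  | halt (b : Bool)

/-- A program is a finite list of instructions, numbered from `0`. -/
abbrev Program : Type := List Instr

/-- A configuration: program counter, register contents, number of queries made so far, and the
answer, if the machine has halted. -/
structure Config : Type where
  pc : ℕ
  reg : ℕ → ℕ
  queries : ℕ
  answer : Option Bool

/-- The symbol at position `a` of the input as a natural number
(`0` if `a` is not a position of the input). -/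
def symbolAt {n q : ℕ} (x : Fin n → Fin q) (a : ℕ) : ℕ :=
  if h : a < n then (x ⟨a, h⟩ : ℕ) else 0

/-- Execution of one instruction by a machine that has not halted. -/
def exec {n q : ℕ} (x : Fin n → Fin q) (c : Config) : Instr → Config
  | .const i a => { c with pc := c.pc + 1, reg := Function.update c.reg i a }
  | .add i j k => { c with pc := c.pc + 1, reg := Function.update c.reg i (c.reg j + c.reg k) }
  | .sub i j k => { c with pc := c.pc + 1, reg := Function.update c.reg i (c.reg j - c.reg k) }
  | .load i j => { c with pc := c.pc + 1, reg := Function.update c.reg i (c.reg (c.reg j)) }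
  | .store i j => { c with pc := c.pc + 1, reg := Function.update c.reg (c.reg i) (c.reg j) }
  | .query i j =>
      { c with
        pc := c.pc + 1
        reg := Function.update c.reg i (symbolAt x (c.reg j))
        queries := c.queries + 1 }
  | .jumpPos j m => { c with pc := if 0 < c.reg j then m else c.pc + 1 }
  | .halt b => { c with answer := some b }

/-- One step. A machine that has halted stays put, and so (without ever giving an answer) does a
machine whose program counter points outside its program. -/
def step {n q : ℕ} (P : Program) (x : Fin n → Fin q) (c : Config) : Config :=
  match c.answer, P[c.pc]? with
  | none, some I => exec x c I
  | _, _ => c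

/-- The initial configuration: `X₀` holds the length `n` of the input and all other registers
hold `0`. -/
def start (n : ℕ) : Config where
  pc := 0
  reg := Function.update (fun _ => 0) 0 n
  queries := 0
  answer := none

/-- The configuration after `t` steps of the program `P` on the input `x`. -/
def run {n q : ℕ} (P : Program) (x : Fin n → Fin q) (t : ℕ) : Config :=
  (step P x)^[t] (start n)

/-- On the input `x` the program `P` halts with the answer `b` after at most `time` steps and at
most `queries` queries, and all numbers that it stores fit into words of `word` bits. -/
def ComputesWithin {n q : ℕ} (P : Program) (x : Fin n → Fin q) (b : Bool)
    (time queries word : ℕ) : Prop :=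
  ∃ T ≤ time, (run P x T).answer = some b ∧ (run P x T).queries ≤ queries ∧
    ∀ t ≤ T, ∀ i, (run P x t).reg i < 2 ^ word

end RAM

/-! ### The quantum query model -/

/-- Labels of the computational basis vectors `|i⟩|z⟩|w⟩`: an input position `i`, a symbol `z`
and a state `w` of the auxiliary work-space of dimension `W`. -/
abbrev QBasis (n q W : ℕ) : Type := Fin n × Fin q × Fin W

/-- The query transformation `|i⟩|z⟩|w⟩ ↦ |i⟩|z + xᵢ mod q⟩|w⟩` as a matrix
(addition in `Fin q` is addition modulo `q`). -/
def queryMatrix {n q W : ℕ} (x : Fin n → Fin q) :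
    Matrix (QBasis n q W) (QBasis n q W) ℂ :=
  Matrix.of fun a b => if a = (b.1, b.2.1 + x b.1, b.2.2) then 1 else 0

/-- A quantum query algorithm for inputs in `(Fin q)ⁿ`: the dimension of the work-space, the
number of queries, the initial basis vector, the unitaries `U₀, …, U_T` (where `T` is the number of
queries; later ones are never applied), and the answer that is given for each outcome of the final
measurement in the computational basis. -/
structure QuantumQueryAlgorithm (n q : ℕ) : Type where
  workDim : ℕ
  queries : ℕ
  init : QBasis n q workDim
  unitary : ℕ → Matrix.unitaryGroup (QBasis n q workDim) ℂ
  answer : QBasis n q workDim → Bool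

namespace QuantumQueryAlgorithm

open scoped Matrix in
/-- The state `U_t O_x U_{t-1} ⋯ U₁ O_x U₀ |init⟩` after `t` queries to the input `x`. -/
def state {n q : ℕ} (A : QuantumQueryAlgorithm n q) (x : Fin n → Fin q) :
    ℕ → QBasis n q A.workDim → ℂ
  | 0 => (A.unitary 0).1 *ᵥ Pi.single A.init 1
  | t + 1 => (A.unitary (t + 1)).1 *ᵥ (queryMatrix x *ᵥ A.state x t)

/-- The probability that the algorithm answers `b` on the input `x`. -/
noncomputable def answerProb {n q : ℕ} (A : QuantumQueryAlgorithm n q) (x : Fin n → Fin q)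
    (b : Bool) : ℝ :=
  ∑ a : QBasis n q A.workDim, if A.answer a = b then ‖A.state x A.queries a‖ ^ 2 else 0

/-- `A` computes `f` with (two-sided) error probability at most `ε` on every input. -/
def ComputesWithError {n q : ℕ} (A : QuantumQueryAlgorithm n q) (f : (Fin n → Fin q) → Bool)
    (ε : ℝ) : Prop :=
  ∀ x, A.answerProb x (!f x) ≤ ε

end QuantumQueryAlgorithm

/-! A word of length `n` lies in the language iff `n` is even and its `n`-periodic extension is
invariant under a reflection `i ↦ j - 1 - i` with `j` even and `0 < j < n` (`REV_eq_true_iff`).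
Equivalently, the reversed word is a nontrivial even rotation of the word.

Quantum part. Composing bounded-error subroutines would cost extra logarithms for error reduction.
Instead, feasible solutions of the dual adversary program are composed. Their costs depend on the
input and add up along a decision procedure: `HasAdv.node` is a test with two continuations,
`HasAdv.search` is a Grover search that continues from a hit, `HasAdv.coin` averages two solutions.
Only at the end does `exists_algorithm_of_hasAdv` turn a solution of cost `W` into an algorithm with
`O(W)` queries for fixed `q`, by averaging powers of a product of two reflections.

The solution for `REV` (`HasAdv.REV_of_liveShifts`) keeps a period `d`, a shift `s` and a list of
sample columns; a shift `t < d` is live if the word looks the same from `t` as from `s` in these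
columns. Given a second live shift `t`, either the rotations by `s` and `t` coincide, so that the
period drops to a proper divisor and the number of live shifts at least halves; or they differ in
some column, which joins the sample and separates the shifts that look like `s` from those that look
like `t`. By AM-GM, continuing with `s` or `t` by a fair coin lowers the logarithm of the number of
live shifts by at least 1 on average. When `s` is alone, all reflections of the word agree modulo
`d` (`dvd_sub_of_reflection`), and a single candidate has to be verified. A round with `k` columns
costs `O(√n (k + 1))`, and `shiftPotential` bounds the total by `O(√n log² n)`.

Classical part. The two-pointer method for comparing cyclic words is restricted to even rotations. A
mismatch after `k` equal symbols shows that a whole block of rotations of one word is not minimal,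
so the block is skipped (`TwoPointerInv`). If the word equals its reverse, the trivial rotation must
be excluded, and a second phase compares the word with itself from two distinct pointers. A
potential bounded by `8 * n` limits the number of iterations. -/

/-! ### A calculus of dual adversary solutions -/

/-- The label `(i, a, b)` stands for the condition that the truth value of `x i = a` is `b`. -/
def LabelHolds {n q : ℕ} (l : Fin n × Fin q × Bool) (x : Fin n → Fin q) : Prop :=
  decide (x l.1 = l.2.1) = l.2.2

instance {n q : ℕ} (l : Fin n × Fin q × Bool) (x : Fin n → Fin q) : Decidable (LabelHolds l x) :=
  inferInstanceAs (Decidable (_ = _))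

/-- A feasible solution of the dual adversary program for `f` on the promise `D`: the vectors
`u x` live on labels that hold for `x`, the vectors `v x` on labels that fail for `x`, both have
squared norm at most `c x`, and `⟪u x, v y⟫ = 1` whenever `f x ≠ f y`. -/
def HasAdv {n q : ℕ} (D : Set (Fin n → Fin q)) (f : (Fin n → Fin q) → Bool)
    (c : (Fin n → Fin q) → ℝ) : Prop :=
  ∃ (H : Type) (_ : Fintype H) (lab : H → Fin n × Fin q × Bool)
    (u v : (Fin n → Fin q) → H → ℝ),
    (∀ x h, ¬ LabelHolds (lab h) x → u x h = 0) ∧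
    (∀ x h, LabelHolds (lab h) x → v x h = 0) ∧
    (∀ x ∈ D, ∀ y ∈ D, f x ≠ f y → ∑ h, u x h * v y h = 1) ∧
    (∀ x ∈ D, ∑ h, u x h ^ 2 ≤ c x) ∧ (∀ x ∈ D, ∑ h, v x h ^ 2 ≤ c x)

namespace HasAdv

variable {n q : ℕ} {D D' : Set (Fin n → Fin q)} {f g : (Fin n → Fin q) → Bool}
  {c c' : (Fin n → Fin q) → ℝ}

theorem mono (h : HasAdv D f c) (hD : D' ⊆ D) (hf : ∀ x ∈ D', g x = f x)
    (hc : ∀ x ∈ D', c x ≤ c' x) : HasAdv D' g c' := by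
  obtain ⟨H, _, lab, u, v, hu, hv, huv, hcu, hcv⟩ := h
  refine ⟨H, _, lab, u, v, hu, hv, fun x hx y hy hxy => huv x (hD hx) y (hD hy) ?_,
    fun x hx => (hcu x (hD hx)).trans (hc x hx), fun x hx => (hcv x (hD hx)).trans (hc x hx)⟩
  rwa [← hf x hx, ← hf y hy]

theorem const {b : Bool} (hf : ∀ x ∈ D, f x = b) (hc : ∀ x ∈ D, 0 ≤ c x) : HasAdv D f c := by
  refine ⟨Empty, inferInstance, Empty.elim, fun _ => Empty.elim, fun _ => Empty.elim,
    fun _ h => h.elim, fun _ h => h.elim, fun x hx y hy hxy => ?_, ?_, ?_⟩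
  · exact absurd ((hf x hx).trans (hf y hy).symm) hxy
  · simpa using hc
  · simpa using hc

theorem not (h : HasAdv D f c) : HasAdv D (fun x => !f x) c := by
  obtain ⟨H, _, lab, u, v, hu, hv, huv, hcu, hcv⟩ := h
  refine ⟨H, _, lab, u, v, hu, hv, fun x hx y hy hxy => huv x hx y hy ?_, hcu, hcv⟩
  simpa using hxy

theorem literal (i : Fin n) (a : Fin q) :
    HasAdv D (fun x => decide (x i = a)) (fun _ => 1) := by
  refine ⟨Bool, inferInstance, fun b => (i, a, b),
    fun x b => if LabelHolds (i, a, b) x then 1 else 0,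
    fun x b => if LabelHolds (i, a, b) x then 0 else 1, ?_, ?_, ?_, ?_, ?_⟩
  · intro x h hx; simp [hx]
  · intro x h hx; simp [hx]
  · intro x _ y _ hxy
    by_cases h1 : x i = a <;> by_cases h2 : y i = a <;> simp_all [LabelHolds]
  · intro x _
    by_cases h1 : x i = a <;> simp [LabelHolds, h1]
  · intro x _
    by_cases h1 : x i = a <;> simp [LabelHolds, h1]

/-- Both solutions already solve `f`, so their direct sum scaled by `√(1/2)` does too. The gain is
in the cost: when it is unknown which of two continuations is cheap for the given input, the average
is paid. -/
theorem coin (h₁ : HasAdv D f c) (h₂ : HasAdv D f c') :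
    HasAdv D f (fun x => (c x + c' x) / 2) := by
  obtain ⟨H, _, lab, u, v, hu, hv, huv, hcu, hcv⟩ := h₁
  obtain ⟨H', _, lab', u', v', hu', hv', huv', hcu', hcv'⟩ := h₂
  have hs : Real.sqrt 2⁻¹ * Real.sqrt 2⁻¹ = 2⁻¹ := Real.mul_self_sqrt (by norm_num)
  have hs2 : Real.sqrt 2⁻¹ ^ 2 = 2⁻¹ := Real.sq_sqrt (by norm_num)
  refine ⟨H ⊕ H', inferInstance, Sum.elim lab lab',
    fun x => Sum.elim (fun h => Real.sqrt 2⁻¹ * u x h) (fun h => Real.sqrt 2⁻¹ * u' x h),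
    fun x => Sum.elim (fun h => Real.sqrt 2⁻¹ * v x h) (fun h => Real.sqrt 2⁻¹ * v' x h),
    ?_, ?_, ?_, ?_, ?_⟩
  · rintro x (h | h) hx
    · simp [hu x h hx]
    · simp [hu' x h hx]
  · rintro x (h | h) hx
    · simp [hv x h hx]
    · simp [hv' x h hx]
  · intro x hx y hy hxy
    have e : ∀ a b : ℝ, Real.sqrt 2⁻¹ * a * (Real.sqrt 2⁻¹ * b) = 2⁻¹ * (a * b) := fun a b => by
      rw [mul_mul_mul_comm, hs]
    simp only [Fintype.sum_sum_type, Sum.elim_inl, Sum.elim_inr, e, ← Finset.mul_sum,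
      huv x hx y hy hxy, huv' x hx y hy hxy]
    norm_num
  · intro x hx
    simp only [Fintype.sum_sum_type, Sum.elim_inl, Sum.elim_inr, mul_pow, hs2, ← Finset.mul_sum]
    linarith [hcu x hx, hcu' x hx]
  · intro x hx
    simp only [Fintype.sum_sum_type, Sum.elim_inl, Sum.elim_inr, mul_pow, hs2, ← Finset.mul_sum]
    linarith [hcv x hx, hcv' x hx]

/-- Pairs on the same side of the test `g` are separated by the solution of that branch, pairs on
different sides by one of two copies of the solution for `g`. Rescaling `u` against `v` leaves the
products unchanged, so the outcome `true` can be made dearer by the factor `β` and `false` cheaper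
by the same factor. -/
theorem node {cg c₁ c₀ : (Fin n → Fin q) → ℝ} (hg : HasAdv D g cg)
    (h₁ : HasAdv {x ∈ D | g x = true} f c₁) (h₀ : HasAdv {x ∈ D | g x = false} f c₀)
    {β : ℝ} (hβ : 0 < β) :
    HasAdv D f (fun x => if g x then β * cg x + c₁ x else cg x / β + c₀ x) := by
  obtain ⟨H, _, lab, u, v, hu, hv, huv, hcu, hcv⟩ := hg
  obtain ⟨H₁, _, lab₁, u₁, v₁, hu₁, hv₁, huv₁, hcu₁, hcv₁⟩ := h₁
  obtain ⟨H₀, _, lab₀, u₀, v₀, hu₀, hv₀, huv₀, hcu₀, hcv₀⟩ := h₀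
  obtain ⟨r, hr, rfl⟩ : ∃ r : ℝ, 0 < r ∧ β = r ^ 2 :=
    ⟨Real.sqrt β, Real.sqrt_pos.2 hβ, (Real.sq_sqrt hβ.le).symm⟩
  -- Copy `b` of `H` pairs `u x` for `g x = b` with `v y` for `g y ≠ b`. The weights are `r` on
  -- inputs with `g = true` and `r⁻¹` on the others, in both copies.
  refine ⟨(H × Bool) ⊕ (H₁ ⊕ H₀), inferInstance,
    Sum.elim (fun h => lab h.1) (Sum.elim lab₁ lab₀),
    fun x => Sum.elim
      (fun h => if g x = h.2 then (if h.2 then r else r⁻¹) * u x h.1 else 0)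
      (Sum.elim (fun h => if g x = true then u₁ x h else 0)
        (fun h => if g x = false then u₀ x h else 0)),
    fun x => Sum.elim
      (fun h => if g x = h.2 then 0 else (if h.2 then r⁻¹ else r) * v x h.1)
      (Sum.elim (fun h => if g x = true then v₁ x h else 0)
        (fun h => if g x = false then v₀ x h else 0)), ?_, ?_, ?_, ?_, ?_⟩
  · rintro x (⟨h, b⟩ | h | h) hx
    · simp [hu x h hx]
    · simp [hu₁ x h hx]
    · simp [hu₀ x h hx]
  · rintro x (⟨h, b⟩ | h | h) hx
    · simp [hv x h hx]
    · simp [hv₁ x h hx]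
    · simp [hv₀ x h hx]
  · intro x hx y hy hxy
    simp only [Fintype.sum_sum_type, Sum.elim_inl, Sum.elim_inr, Fintype.sum_prod_type,
      Fintype.sum_bool]
    rcases hgx : g x <;> rcases hgy : g y
    · simpa using huv₀ x ⟨hx, hgx⟩ y ⟨hy, hgy⟩ hxy
    · have := huv x hx y hy (by simp [hgx, hgy])
      simp only [Bool.false_eq_true, if_false, if_true, reduceCtorEq, zero_mul, mul_zero, zero_add,
        Finset.sum_const_zero, add_zero]
      rw [← this]
      refine Finset.sum_congr rfl fun h _ => ?_
      field_simp
    · have := huv x hx y hy (by simp [hgx, hgy])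
      simp only [Bool.false_eq_true, if_false, if_true, zero_mul, mul_zero,
        Finset.sum_const_zero, add_zero, Bool.true_eq_false]
      rw [← this]
      refine Finset.sum_congr rfl fun h _ => ?_
      field_simp
    · simpa using huv₁ x ⟨hx, hgx⟩ y ⟨hy, hgy⟩ hxy
  · intro x hx
    simp only [Fintype.sum_sum_type, Sum.elim_inl, Sum.elim_inr, Fintype.sum_prod_type,
      Fintype.sum_bool]
    rcases hgx : g x
    · have h2 := hcu₀ x ⟨hx, hgx⟩
      have h3 := mul_le_mul_of_nonneg_left (hcu x hx) (by positivity : 0 ≤ r⁻¹ ^ 2)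
      simp only [Bool.false_eq_true, if_false, if_true, ne_eq, OfNat.ofNat_ne_zero,
        not_false_eq_true, zero_pow, zero_add, mul_pow, Finset.sum_const_zero, ← Finset.mul_sum]
      have : cg x / r ^ 2 = r⁻¹ ^ 2 * cg x := by field_simp
      linarith
    · have h2 := hcu₁ x ⟨hx, hgx⟩
      have h3 := mul_le_mul_of_nonneg_left (hcu x hx) (by positivity : 0 ≤ r ^ 2)
      simp only [Bool.true_eq_false, if_false, if_true, ne_eq, OfNat.ofNat_ne_zero,
        not_false_eq_true, zero_pow, mul_pow, Finset.sum_const_zero, add_zero, ← Finset.mul_sum]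
      linarith
  · intro x hx
    simp only [Fintype.sum_sum_type, Sum.elim_inl, Sum.elim_inr, Fintype.sum_prod_type,
      Fintype.sum_bool]
    rcases hgx : g x
    · have h2 := hcv₀ x ⟨hx, hgx⟩
      have h3 := mul_le_mul_of_nonneg_left (hcv x hx) (by positivity : 0 ≤ r⁻¹ ^ 2)
      simp only [Bool.false_eq_true, if_false, if_true, ne_eq, OfNat.ofNat_ne_zero,
        not_false_eq_true, zero_pow, zero_add, mul_pow, Finset.sum_const_zero, add_zero,
        ← Finset.mul_sum]
      have : cg x / r ^ 2 = r⁻¹ ^ 2 * cg x := by field_simp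
      linarith
    · have h2 := hcv₁ x ⟨hx, hgx⟩
      have h3 := mul_le_mul_of_nonneg_left (hcv x hx) (by positivity : 0 ≤ r ^ 2)
      simp only [Bool.true_eq_false, Bool.false_eq_true, if_false, if_true, ne_eq, OfNat.ofNat_ne_zero,
        not_false_eq_true, zero_pow, zero_add, mul_pow, Finset.sum_const_zero, add_zero,
        ← Finset.mul_sum]
      linarith

/-- The candidates are tested one after another with `node`: every miss costs `κ / β`, and the only
hit costs `κ * β`, since the search then stops. -/
theorem search_aux {ι : Type*} {p : ι → (Fin n → Fin q) → Bool} {κ β : ℝ} (hβ : 0 < β)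
    (hκ : 0 ≤ κ) (l : List ι) : ∀ {D : Set (Fin n → Fin q)},
    (∀ a ∈ l, HasAdv D (p a) fun _ => κ) →
    (∀ a ∈ l, HasAdv {x ∈ D | p a x = true} f c) →
    HasAdv {x ∈ D | ∀ a ∈ l, p a x = false} f c →
    HasAdv D f (fun x => c x + κ * (l.length / β + β)) := by
  induction l with
  | nil =>
    intro D _ _ h
    exact h.mono (fun x hx => ⟨hx, by simp⟩) (fun _ _ => rfl)
      fun x _ => by simp; positivity
  | cons a l ih =>
    intro D hp ht hn
    have h0 : HasAdv {x ∈ D | p a x = false} f (fun x => c x + κ * (l.length / β + β)) := by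
      refine ih (fun b hb => (hp b (List.mem_cons_of_mem _ hb)).mono (fun x hx => hx.1)
        (fun _ _ => rfl) fun _ _ => le_rfl) (fun b hb => ?_) ?_
      · exact (ht b (List.mem_cons_of_mem _ hb)).mono (fun x hx => ⟨hx.1.1, hx.2⟩)
          (fun _ _ => rfl) fun _ _ => le_rfl
      · refine hn.mono (fun x hx => ⟨hx.1.1, ?_⟩) (fun _ _ => rfl) fun _ _ => le_rfl
        simp only [List.mem_cons, forall_eq_or_imp]
        exact ⟨hx.1.2, hx.2⟩
    refine (node (hp a (by simp)) (ht a (by simp)) h0 hβ).mono subset_rfl (fun _ _ => rfl) ?_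
    intro x _
    rw [List.length_cons]
    push_cast
    split_ifs
    · have : 0 ≤ κ * (((l.length : ℝ) + 1) / β) := by positivity
      linarith
    · apply le_of_eq
      field_simp
      ring

/-- The choice `β = √(m + 1)` balances the misses against the hit. The cost `c` of the continuation
is not multiplied by the cost of the search, which is what makes nested rounds affordable. -/
theorem search {ι : Type*} {p : ι → (Fin n → Fin q) → Bool} {κ : ℝ}
    (hκ : 0 ≤ κ) {l : List ι} {m : ℕ} (hl : l.length ≤ m)
    (hp : ∀ a ∈ l, HasAdv D (p a) fun _ => κ)
    (ht : ∀ a ∈ l, HasAdv {x ∈ D | p a x = true} f c)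
    (hn : HasAdv {x ∈ D | ∀ a ∈ l, p a x = false} f c) :
    HasAdv D f (fun x => c x + κ * (2 * Real.sqrt (m + 1))) := by
  have hpos : 0 < Real.sqrt ((m : ℝ) + 1) := Real.sqrt_pos.2 (by positivity)
  refine (search_aux hpos hκ l hp ht hn).mono subset_rfl (fun _ _ => rfl) fun x _ => ?_
  gcongr
  have : (l.length : ℝ) / Real.sqrt (m + 1) ≤ Real.sqrt (m + 1) := by
    rw [div_le_iff₀ hpos, Real.mul_self_sqrt (by positivity)]
    have : (l.length : ℝ) ≤ m := by exact_mod_cast hl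
    linarith
  linarith

theorem forall_mem {ι : Type*} {p : ι → (Fin n → Fin q) → Prop} [∀ a x, Decidable (p a x)]
    {κ : ℝ} (hκ : 0 ≤ κ) (l : List ι)
    (hp : ∀ a, HasAdv D (fun x => decide (p a x)) fun _ => κ) :
    HasAdv D (fun x => decide (∀ a ∈ l, p a x))
      (fun _ => κ * (2 * Real.sqrt (l.length + 1))) := by
  refine (search (p := fun a x => !decide (p a x)) (c := fun _ => 0) hκ (l := l) le_rfl
    (fun a _ => (hp a).not) (fun a ha => ?_) ?_).mono subset_rfl (fun _ _ => rfl)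
    fun x _ => by simp
  · refine const (b := false) (fun x hx => ?_) fun _ _ => le_rfl
    have := hx.2
    simp only [Bool.not_eq_true', decide_eq_false_iff_not] at this
    simpa using ⟨a, ha, this⟩
  · refine const (b := true) (fun x hx => ?_) fun _ _ => le_rfl
    simpa using hx.2

/-- The cost of comparing two input symbols. -/
noncomputable def eqCost (q : ℕ) : ℝ := 1 + 1 * (2 * Real.sqrt (q + 1))

theorem eqCost_pos (q : ℕ) : 0 < eqCost q := by unfold eqCost; positivity

theorem eq_test (i j : Fin n) :
    HasAdv D (fun x => decide (x i = x j)) fun _ => eqCost q := by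
  refine search (p := fun a x => decide (x i = a)) (c := fun _ => 1) zero_le_one
    (l := List.finRange q) (by simp) (fun a _ => literal i a) (fun a _ => ?_) ?_
  · refine (literal j a).mono (Set.subset_univ _) (fun x hx => ?_) fun _ _ => le_rfl
    have := of_decide_eq_true hx.2
    simp [this, eq_comm]
  · refine const (b := true) (fun x hx => ?_) fun _ _ => zero_le_one
    have := hx.2 (x i) (by simp)
    simp at this

end HasAdv

/-! ### Unitary matrices -/

section Unitary

open scoped Matrix Kronecker
open Matrix (unitaryGroup)

variable {ι κ : Type*} [Fintype ι] [DecidableEq ι] [Fintype κ] [DecidableEq κ]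

theorem norm_mulVec_of_unitary (U : unitaryGroup ι ℂ) (z : ι → ℂ) :
    ‖WithLp.toLp 2 (U.1 *ᵥ z)‖ = ‖WithLp.toLp 2 z‖ := by
  have hU : Matrix.toEuclideanCLM (𝕜 := ℂ) U.1 ∈ unitary _ := Unitary.map_mem (Matrix.toEuclideanCLM (𝕜 := ℂ) (n := ι)) U.2
  exact ContinuousLinearMap.norm_map_of_mem_unitary hU (WithLp.toLp 2 z)

theorem sum_norm_sq_mulVec_of_unitary (U : unitaryGroup ι ℂ) (z : ι → ℂ) :
    ∑ a, ‖(U.1 *ᵥ z) a‖ ^ 2 = ∑ a, ‖z a‖ ^ 2 := by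
  have := congrArg (· ^ 2) (norm_mulVec_of_unitary U z)
  simpa only [EuclideanSpace.norm_sq_eq] using this

theorem star_dotProduct_mulVec_of_unitary (U : unitaryGroup ι ℂ) (y z : ι → ℂ) :
    star (U.1 *ᵥ y) ⬝ᵥ (U.1 *ᵥ z) = star y ⬝ᵥ z := by
  rw [Matrix.star_mulVec, Matrix.dotProduct_mulVec, Matrix.vecMul_vecMul,
    ← Matrix.star_eq_conjTranspose, Matrix.mem_unitaryGroup_iff'.1 U.2, Matrix.vecMul_one]

/-- Reflection about the span of a set of vectors. -/
theorem exists_unitary_reflection (S : Set (ι → ℂ)) :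
    ∃ U : unitaryGroup ι ℂ, (∀ ψ ∈ S, U.1 *ᵥ ψ = ψ) ∧
      ∀ w, (∀ ψ ∈ S, star ψ ⬝ᵥ w = 0) → U.1 *ᵥ w = -w := by
  let K : Submodule ℂ (EuclideanSpace ℂ ι) := Submodule.span ℂ (WithLp.toLp 2 '' S)
  let T : unitary (EuclideanSpace ℂ ι →L[ℂ] EuclideanSpace ℂ ι) :=
    Unitary.linearIsometryEquiv.symm K.reflection
  have hT : ∀ z, T.1 z = K.reflection z := fun z => rfl
  let e := Matrix.toEuclideanCLM (𝕜 := ℂ) (n := ι)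
  have key : ∀ z : ι → ℂ, (e.symm T.1) *ᵥ z = (K.reflection (WithLp.toLp 2 z)).ofLp := by
    intro z
    rw [← hT]
    conv_rhs => rw [← e.apply_symm_apply T.1]
    rfl
  refine ⟨⟨e.symm T.1, Unitary.map_mem e.symm T.2⟩, fun ψ hψ => ?_, fun w hw => ?_⟩
  · change (e.symm T.1) *ᵥ ψ = ψ
    rw [key, Submodule.reflection_mem_subspace_eq_self (K := K)
      (Submodule.subset_span (Set.mem_image_of_mem _ hψ))]
  · change (e.symm T.1) *ᵥ w = -w
    rw [key, Submodule.reflection_mem_subspace_orthogonalComplement_eq_neg]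
    · rfl
    · rw [Submodule.mem_orthogonal]
      intro u hu
      induction hu using Submodule.span_induction with
      | mem x hx =>
        obtain ⟨ψ, hψ, rfl⟩ := hx
        rw [EuclideanSpace.inner_eq_star_dotProduct, dotProduct_comm]
        exact hw ψ hψ
      | zero => simp
      | add x y _ _ hx hy => simp [inner_add_left, hx, hy]
      | smul a x _ hx => simp [inner_smul_left, hx]

theorem exists_unitary_diagonal (d : ι → ℂ) (hd : ∀ i, star (d i) * d i = 1) :
    ∃ U : unitaryGroup ι ℂ, ∀ z, U.1 *ᵥ z = fun i => d i * z i := by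
  refine ⟨⟨Matrix.diagonal d, ?_⟩, fun z => by ext i; simp [Matrix.mulVec_diagonal]⟩
  rw [Matrix.mem_unitaryGroup_iff', Matrix.star_eq_conjTranspose, Matrix.diagonal_conjTranspose,
    Matrix.diagonal_mul_diagonal]
  simp only [Pi.star_apply, hd, Matrix.diagonal_one]

theorem exists_unitary_perm (σ : Equiv.Perm ι) :
    ∃ U : unitaryGroup ι ℂ, ∀ z, U.1 *ᵥ z = z ∘ σ := by
  refine ⟨⟨σ.permMatrix ℂ, ?_⟩, fun z => Matrix.permMatrix_mulVec σ⟩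
  rw [Matrix.mem_unitaryGroup_iff', Matrix.star_eq_conjTranspose, Matrix.conjTranspose_permMatrix,
    ← Matrix.permMatrix_mul]
  simp

theorem exists_unitary_reindex (e : ι ≃ κ) (U : unitaryGroup κ ℂ) :
    ∃ V : unitaryGroup ι ℂ, ∀ z, V.1 *ᵥ z = (U.1 *ᵥ (z ∘ e.symm)) ∘ e := by
  refine ⟨⟨U.1.submatrix e e, ?_⟩, fun z => Matrix.submatrix_mulVec_equiv _ _ _ _⟩
  rw [Matrix.mem_unitaryGroup_iff', Matrix.star_eq_conjTranspose, Matrix.conjTranspose_submatrix,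
    Matrix.submatrix_mul_equiv, ← Matrix.star_eq_conjTranspose, Matrix.mem_unitaryGroup_iff'.1 U.2,
    Matrix.submatrix_one_equiv]

/-- A family of unitaries controlled by the second component. -/
theorem exists_unitary_controlled (U : κ → unitaryGroup ι ℂ) :
    ∃ V : unitaryGroup (ι × κ) ℂ, ∀ z i k, (V.1 *ᵥ z) (i, k) =
      ((U k).1 *ᵥ fun j => z (j, k)) i := by
  refine ⟨⟨Matrix.blockDiagonal fun k => (U k).1, ?_⟩, fun z i k => ?_⟩
  · rw [Matrix.mem_unitaryGroup_iff', Matrix.star_eq_conjTranspose,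
      Matrix.blockDiagonal_conjTranspose, ← Matrix.blockDiagonal_mul]
    have : ∀ k, (U k).1ᴴ * (U k).1 = 1 := fun k => Matrix.mem_unitaryGroup_iff'.1 (U k).2
    simp only [this]
    exact Matrix.blockDiagonal_one
  · simp only [Matrix.mulVec, dotProduct, Matrix.blockDiagonal_apply, Fintype.sum_prod_type]
    refine Finset.sum_congr rfl fun j _ => ?_
    simp [ite_mul]

/-- A unitary involution that maps a basis vector to the uniform superposition. -/
theorem exists_unitary_uniform (k : κ) :
    ∃ U : unitaryGroup κ ℂ,
      (U.1 *ᵥ Pi.single k 1 = fun _ => ((Real.sqrt (Fintype.card κ))⁻¹ : ℂ)) ∧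
      ∀ z : κ → ℂ, (U.1 *ᵥ z) k = (Real.sqrt (Fintype.card κ) : ℂ)⁻¹ * ∑ j, z j := by
  have : Nonempty κ := ⟨k⟩
  set s : ℂ := (Real.sqrt (Fintype.card κ) : ℂ)⁻¹ with hs
  have hss : (Fintype.card κ : ℂ) * (s * s) = 1 := by
    rw [hs, ← mul_inv, ← Complex.ofReal_mul, Real.mul_self_sqrt (by positivity)]
    push_cast
    exact mul_inv_cancel₀ (Nat.cast_ne_zero.2 Fintype.card_ne_zero)
  have hstar : star s = s := by simp [hs]
  set u : κ → ℂ := fun _ => s with hu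
  set e : κ → ℂ := Pi.single k 1 with he
  -- Since `e` and `u` are real unit vectors, `e - u` is orthogonal to `e + u`, and the reflection
  -- about `e + u` swaps `e` and `u`.
  obtain ⟨U, h1, h2⟩ := exists_unitary_reflection ({e + u} : Set (κ → ℂ))
  have h1 := h1 (e + u) rfl
  have estar : star e = e := by
    rw [he, ← Pi.single_star, star_one]
  have ustar : star u = u := by ext; simp [hu, hstar]
  have h2 := h2 (e - u) (by
    rintro _ rfl
    simp only [star_add, estar, ustar, add_dotProduct, dotProduct_sub]
    simp [he, hu, dotProduct, Pi.single_apply, hss, add_comm])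
  have hUe : U.1 *ᵥ e = u := by
    have h3 : e = (2⁻¹ : ℂ) • ((e + u) + (e - u)) := by
      ext; simp; ring
    rw [h3, Matrix.mulVec_smul, Matrix.mulVec_add, h1, h2]
    ext; simp; ring
  have hUu : U.1 *ᵥ u = e := by
    rw [Matrix.mulVec_add, hUe] at h1
    have : U.1 *ᵥ u = e + u - u := by rw [← h1]; simp
    simpa using this
  refine ⟨U, hUe, fun z => ?_⟩
  have h4 := star_dotProduct_mulVec_of_unitary U u z
  rw [hUu, estar, ustar] at h4
  simpa [he, hu, dotProduct, Pi.single_apply, ← Finset.mul_sum] using h4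

end Unitary

/-! ### From dual adversary solutions to quantum query algorithms -/

/-! ### Averages of the powers of a unitary -/

section Averages

open scoped Matrix
open Matrix (unitaryGroup)

variable {ι : Type*} [Fintype ι] [DecidableEq ι]

/-- The average of the first `K` iterates of `R` on `z`. -/
noncomputable def iterateAverage (R : unitaryGroup ι ℂ) (K : ℕ) (z : ι → ℂ) : ι → ℂ :=
  (K : ℂ)⁻¹ • ∑ t : Fin K, (R ^ (t : ℕ)).1 *ᵥ z

theorem unitary_pow_succ_mulVec (R : unitaryGroup ι ℂ) (t : ℕ) (z : ι → ℂ) :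
    (R ^ (t + 1)).1 *ᵥ z = R.1 *ᵥ ((R ^ t).1 *ᵥ z) := by
  rw [pow_succ', Matrix.mulVec_mulVec]
  rfl

theorem norm_star_dotProduct_le {κ : Type*} [Fintype κ] (y z : κ → ℂ) :
    ‖star y ⬝ᵥ z‖ ≤ ‖WithLp.toLp 2 y‖ * ‖WithLp.toLp 2 z‖ := by
  have := norm_inner_le_norm (𝕜 := ℂ) (WithLp.toLp 2 y) (WithLp.toLp 2 z)
  rwa [EuclideanSpace.inner_eq_star_dotProduct, dotProduct_comm] at this

/-- Averaging preserves the inner product with a fixed vector of `R`. A start vector that overlaps a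
fixed vector therefore keeps a large average (accepting case). -/
theorem norm_star_dotProduct_le_iterateAverage (R : unitaryGroup ι ℂ) {K : ℕ} (hK : 0 < K)
    {ψ : ι → ℂ} (hψ : R.1 *ᵥ ψ = ψ) (z : ι → ℂ) :
    ‖star ψ ⬝ᵥ z‖ ≤ ‖WithLp.toLp 2 ψ‖ * ‖WithLp.toLp 2 (iterateAverage R K z)‖ := by
  have hpow : ∀ t : ℕ, (R ^ t).1 *ᵥ ψ = ψ := by
    intro t
    induction t with
    | zero => simp
    | succ t ih => rw [unitary_pow_succ_mulVec, ih, hψ]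
  have h1 : ∀ t : ℕ, star ψ ⬝ᵥ ((R ^ t).1 *ᵥ z) = star ψ ⬝ᵥ z := fun t => by
    conv_lhs => rw [← hpow t]
    exact star_dotProduct_mulVec_of_unitary _ _ _
  have h2 : star ψ ⬝ᵥ iterateAverage R K z = star ψ ⬝ᵥ z := by
    rw [iterateAverage, dotProduct_smul, dotProduct_sum]
    simp only [h1, Finset.sum_const, Finset.card_univ, Fintype.card_fin, nsmul_eq_mul, smul_eq_mul]
    rw [inv_mul_cancel_left₀ (by exact_mod_cast hK.ne')]
  rw [← h2]
  exact norm_star_dotProduct_le _ _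

/-- For a coboundary `z = (w - R w) / 2` the sum of the iterates telescopes, so the average decays
like `‖w‖ / K` (rejecting case). This elementary argument replaces phase estimation. -/
theorem norm_iterateAverage_le (R : unitaryGroup ι ℂ) {K : ℕ} (hK : 0 < K) {w z : ι → ℂ}
    (hw : w - R.1 *ᵥ w = (2 : ℂ) • z) :
    K * ‖WithLp.toLp 2 (iterateAverage R K z)‖ ≤ ‖WithLp.toLp 2 w‖ := by
  have hz : z = (2⁻¹ : ℂ) • (w - R.1 *ᵥ w) := by rw [hw, smul_smul]; simp
  have hsum : ∀ m : ℕ, ∑ t : Fin m, (R ^ (t : ℕ)).1 *ᵥ z =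
      (2⁻¹ : ℂ) • (w - (R ^ m).1 *ᵥ w) := by
    intro m
    induction m with
    | zero => simp
    | succ m ih =>
      rw [Fin.sum_univ_castSucc]
      simp only [Fin.val_castSucc, Fin.val_last]
      rw [ih, hz, Matrix.mulVec_smul, Matrix.mulVec_sub, ← smul_add]
      have : (R ^ m).1 *ᵥ (R.1 *ᵥ w) = (R ^ (m + 1)).1 *ᵥ w := by
        rw [pow_succ, Matrix.mulVec_mulVec]; rfl
      rw [this]
      simp
  have h3 : (K : ℂ) • iterateAverage R K z = (2⁻¹ : ℂ) • (w - (R ^ K).1 *ᵥ w) := by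
    rw [iterateAverage, smul_inv_smul₀ (by exact_mod_cast hK.ne'), hsum]
  have h4 := congrArg (fun y => ‖WithLp.toLp 2 y‖) h3
  simp only [WithLp.toLp_smul, norm_smul, Complex.norm_natCast] at h4
  rw [h4, WithLp.toLp_sub]
  have h5 := norm_sub_le (WithLp.toLp 2 w) (WithLp.toLp 2 ((R ^ K).1 *ᵥ w))
  rw [norm_mulVec_of_unitary] at h5
  rw [norm_inv, Complex.norm_ofNat]
  linarith

end Averages

/-! ### States that can be prepared with a given number of queries -/

section Preparation

open scoped Matrix
open Matrix (unitaryGroup)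

variable {n q W : ℕ}

theorem queryMatrix_mulVec [NeZero q] (x : Fin n → Fin q) (φ : QBasis n q W → ℂ) (i : Fin n)
    (z : Fin q) (w : Fin W) :
    (queryMatrix x *ᵥ φ) (i, z, w) = φ (i, z - x i, w) := by
  have h : ∀ b : QBasis n q W,
      ((i, z, w) = (b.1, b.2.1 + x b.1, b.2.2)) ↔ (i, z - x i, w) = b := by
    rintro ⟨i', z', w'⟩
    simp only [Prod.mk.injEq]
    constructor
    · rintro ⟨rfl, rfl, rfl⟩; simp
    · rintro ⟨rfl, rfl, rfl⟩; simp
  simp only [Matrix.mulVec, dotProduct, queryMatrix, Matrix.of_apply, h, ite_mul, one_mul,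
    zero_mul, Finset.sum_ite_eq, Finset.mem_univ, if_true]

theorem sum_norm_sq_queryMatrix [NeZero q] (x : Fin n → Fin q) (φ : QBasis n q W → ℂ) :
    ∑ a, ‖(queryMatrix x *ᵥ φ) a‖ ^ 2 = ∑ a, ‖φ a‖ ^ 2 := by
  simp only [Fintype.sum_prod_type, queryMatrix_mulVec]
  refine Finset.sum_congr rfl fun i _ => ?_
  exact Equiv.sum_comp (Equiv.subRight (x i)) (fun z => ∑ w, ‖φ (i, z, w)‖ ^ 2)

namespace QuantumQueryAlgorithm

theorem sum_norm_sq_state [NeZero q] (A : QuantumQueryAlgorithm n q) (x : Fin n → Fin q) (t : ℕ) :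
    ∑ a, ‖A.state x t a‖ ^ 2 = 1 := by
  induction t with
  | zero =>
    rw [state, sum_norm_sq_mulVec_of_unitary, Finset.sum_eq_single A.init]
    · simp
    · intro b _ hb; simp [hb]
    · simp
  | succ t ih => rw [state, sum_norm_sq_mulVec_of_unitary, sum_norm_sq_queryMatrix, ih]

theorem answerProb_true_add_false [NeZero q] (A : QuantumQueryAlgorithm n q)
    (x : Fin n → Fin q) : A.answerProb x true + A.answerProb x false = 1 := by
  rw [← A.sum_norm_sq_state x A.queries, answerProb, answerProb, ← Finset.sum_add_distrib]
  refine Finset.sum_congr rfl fun a _ => ?_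
  cases A.answer a <;> simp

theorem state_congr {Q Q' : ℕ} {s : QBasis n q W} {U U' : ℕ → unitaryGroup (QBasis n q W) ℂ}
    {r r' : QBasis n q W → Bool} (x : Fin n → Fin q) {t : ℕ} (h : ∀ j ≤ t, U j = U' j) :
    (mk W Q s U r).state x t = (mk W Q' s U' r').state x t := by
  induction t with
  | zero => simp only [state, h 0 le_rfl]
  | succ t ih =>
    simp only [state, h (t + 1) le_rfl]
    rw [ih fun j hj => h j (by omega)]

end QuantumQueryAlgorithm

open QuantumQueryAlgorithm

/-- The states `Ψ x` can be prepared with `m` queries to `x`. -/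
def Preparable (m : ℕ) (Ψ : (Fin n → Fin q) → QBasis n q W → ℂ) : Prop :=
  ∃ (s : QBasis n q W) (U : ℕ → unitaryGroup (QBasis n q W) ℂ),
    ∀ x, (QuantumQueryAlgorithm.mk W m s U fun _ => false).state x m = Ψ x

namespace Preparable

variable {m : ℕ} {Ψ : (Fin n → Fin q) → QBasis n q W → ℂ}

theorem init (s : QBasis n q W) :
    Preparable 0 (fun _ : Fin n → Fin q => Pi.single (M := fun _ => ℂ) s 1) :=
  ⟨s, fun _ => 1, fun x => by rw [state]; exact Matrix.one_mulVec _⟩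

theorem unitary (h : Preparable m Ψ) (V : unitaryGroup (QBasis n q W) ℂ) :
    Preparable m fun x => V.1 *ᵥ Ψ x := by
  obtain ⟨s, U, hU⟩ := h
  refine ⟨s, Function.update U m (V * U m), fun x => ?_⟩
  beta_reduce
  rw [← hU x]
  cases m with
  | zero =>
    simp only [state, Function.update_self]
    exact (Matrix.mulVec_mulVec _ _ _).symm
  | succ m =>
    simp only [state, Function.update_self, Matrix.mulVec_mulVec]
    rw [state_congr (U' := U) (Q' := m + 1) (r' := fun _ => false) x
      fun j hj => Function.update_of_ne (by omega) _ _]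
    simp [Matrix.mul_assoc]

theorem query (h : Preparable m Ψ) : Preparable (m + 1) fun x => queryMatrix x *ᵥ Ψ x := by
  obtain ⟨s, U, hU⟩ := h
  refine ⟨s, Function.update U (m + 1) 1, fun x => ?_⟩
  beta_reduce
  rw [← hU x]
  simp only [state, Function.update_self]
  rw [state_congr (U' := U) (Q' := m) (r' := fun _ => false) x
    fun j hj => Function.update_of_ne (by omega) _ _]
  simp

theorem query_iterate [NeZero q] (h : Preparable m Ψ) (r : ℕ) :
    Preparable (m + r) fun x a => Ψ x (a.1, a.2.1 - r • x a.1, a.2.2) := by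
  induction r with
  | zero => simpa using h
  | succ r ih =>
    have := ih.query
    rw [← add_assoc]
    convert this using 3 with x a
    rw [queryMatrix_mulVec, succ_nsmul, sub_sub, add_comm]

end Preparable

variable {B : Type*} [NeZero n] [NeZero q]

/-- A vector on the work-space as a state with clean query registers. -/
def embedState (e : B ≃ Fin W) (φ : B → ℂ) : QBasis n q W → ℂ :=
  fun a => if a.1 = 0 ∧ a.2.1 = 0 then φ (e.symm a.2.2) else 0

theorem sum_embedState [Fintype B] (e : B ≃ Fin W) (φ : B → ℂ) (p : B → Prop) [DecidablePred p] :
    ∑ a : QBasis n q W, (if p (e.symm a.2.2) then ‖embedState e φ a‖ ^ 2 else 0) =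
      ∑ b, if p b then ‖φ b‖ ^ 2 else 0 := by
  simp only [Fintype.sum_prod_type]
  rw [Finset.sum_eq_single 0, Finset.sum_eq_single 0]
  · rw [← Equiv.sum_comp e]
    simp [embedState]
  · intro z _ hz
    simp [embedState, hz]
  · simp
  · intro i _ hi
    simp [embedState, hi]
  · simp

namespace Preparable

variable {m : ℕ} {φ : (Fin n → Fin q) → B → ℂ} {e : B ≃ Fin W}

theorem init_embedState [DecidableEq B] (e : B ≃ Fin W) (b : B) :
    Preparable 0 (fun _ : Fin n → Fin q => embedState (n := n) (q := q) e (Pi.single b 1)) := by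
  convert init (n := n) (q := q) (0, 0, e b) using 2 with x
  ext ⟨i, z, w⟩
  simp only [embedState, Pi.single_apply, Prod.mk.injEq, Equiv.symm_apply_eq]
  by_cases hi : i = 0 <;> by_cases hz : z = 0 <;> simp [hi, hz]

theorem unitary_embedState [Fintype B] [DecidableEq B] (h : Preparable m fun x => embedState (n := n) (q := q) e (φ x))
    (V : unitaryGroup B ℂ) :
    Preparable m fun x => embedState (n := n) (q := q) e (V.1 *ᵥ φ x) := by
  obtain ⟨V₁, hV₁⟩ := exists_unitary_controlled fun _ : Fin n × Fin q => V
  let σ : QBasis n q W ≃ B × (Fin n × Fin q) :=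
    { toFun := fun a => (e.symm a.2.2, (a.1, a.2.1))
      invFun := fun b => (b.2.1, b.2.2, e b.1)
      left_inv := fun a => by simp
      right_inv := fun b => by simp }
  obtain ⟨V₂, hV₂⟩ := exists_unitary_reindex σ V₁
  convert h.unitary V₂ using 2 with x
  rw [hV₂]
  ext ⟨i, z, w⟩
  change _ = (V₁.1 *ᵥ _) (e.symm w, (i, z))
  rw [hV₁]
  by_cases hi : i = 0 ∧ z = 0
  · simp [embedState, hi, σ]
  · have : (fun j => (embedState (n := n) (q := q) e (φ x) ∘ σ.symm) (j, i, z)) = 0 := by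
      ext j
      simp only [σ, embedState, Function.comp_apply, Equiv.coe_fn_symm_mk, if_neg hi,
        Pi.zero_apply]
    rw [this]
    simp only [embedState, if_neg hi, Matrix.mulVec_zero, Pi.zero_apply]

/-- Move the position register to `pos b`, query once to load the symbol, apply the phase, and query
`q - 1` more times: adding a symbol `q` times gives `0` in `Fin q`, so the registers are clean again
without inverse queries. -/
theorem phase_embedState (h : Preparable m fun x => embedState (n := n) (q := q) e (φ x))
    (pos : B → Fin n) (d : B → Fin q → ℂ) (hd : ∀ b a, star (d b a) * d b a = 1) :
    Preparable (m + q) fun x =>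
      embedState (n := n) (q := q) e fun b => d b (x (pos b)) * φ x b := by
  let σ : Equiv.Perm (QBasis n q W) :=
    { toFun := fun a => (a.1 - pos (e.symm a.2.2), a.2)
      invFun := fun a => (a.1 + pos (e.symm a.2.2), a.2)
      left_inv := fun a => by simp
      right_inv := fun a => by simp }
  obtain ⟨V₁, hV₁⟩ := exists_unitary_perm σ
  obtain ⟨V₂, hV₂⟩ := exists_unitary_diagonal
    (fun a : QBasis n q W => d (e.symm a.2.2) a.2.1) fun a => hd _ _
  obtain ⟨V₃, hV₃⟩ := exists_unitary_perm σ.symm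
  have hq : m + q = m + 1 + (q - 1) := by have := NeZero.pos q; omega
  rw [hq]
  convert (((h.unitary V₁).query.unitary V₂).query_iterate (q - 1)).unitary V₃ using 2 with x
  rw [hV₃]
  ext ⟨i, z, w⟩
  simp only [Function.comp_apply, hV₂, hV₁, queryMatrix_mulVec]
  have hs : ∀ a : Fin q, (q - 1) • a + a = 0 := fun a => by
    rw [← succ_nsmul, Nat.sub_add_cancel (NeZero.pos q)]
    have := card_nsmul_eq_zero' (x := a)
    simpa using this
  have hs' : ∀ a : Fin q, -((q - 1) • a) = a := fun a => by
    rw [neg_eq_iff_add_eq_zero, hs]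
  simp only [σ, Equiv.coe_fn_mk, Equiv.coe_fn_symm_mk, embedState, add_sub_cancel_right, sub_sub,
    hs, sub_zero]
  by_cases hi : i = 0 ∧ z = 0
  · obtain ⟨rfl, rfl⟩ := hi
    simp [hs']
  · simp [hi]

end Preparable

end Preparation

/-! ### From reflections to an algorithm -/

section Algorithm

open scoped Matrix
open Matrix (unitaryGroup)

variable {n q : ℕ} [NeZero n] [NeZero q]

/-- Acceptance by the average of the first `K` powers of a product of two reflections. -/
theorem exists_algorithm_of_reflections {H : Type} [Fintype H] [DecidableEq H]
    (lab : H → Fin n × Fin q × Bool) {f : (Fin n → Fin q) → Bool} {K : ℕ} (hK : 0 < K) {ε : ℝ}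
    (U : unitaryGroup (Option H) ℂ)
    (R : (Fin n → Fin q) → unitaryGroup (Option H) ℂ)
    (hR : ∀ x z, (R x).1 *ᵥ z = fun h =>
      (h.elim 1 fun h => if LabelHolds (lab h) x then 1 else -1) * (U.1 *ᵥ z) h)
    (h₁ : ∀ x, f x = true →
      1 - ε ≤ ‖WithLp.toLp 2 (iterateAverage (R x) K (Pi.single none 1))‖ ^ 2)
    (h₀ : ∀ x, f x = false →
      ‖WithLp.toLp 2 (iterateAverage (R x) K (Pi.single none 1))‖ ^ 2 ≤ ε) :
    ∃ A : QuantumQueryAlgorithm n q, A.queries = K * q ∧ A.ComputesWithError f ε := by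
  have : NeZero K := ⟨hK.ne'⟩
  let B := Option H × Fin K
  let e : B ≃ Fin (Fintype.card B) := Fintype.equivFin B
  obtain ⟨F, hF, hF'⟩ := exists_unitary_uniform (0 : Fin K)
  rw [Fintype.card_fin] at hF hF'
  obtain ⟨F₁, hF₁⟩ := exists_unitary_controlled fun _ : Option H => F
  obtain ⟨F₂, hF₂⟩ := exists_unitary_reindex (Equiv.prodComm (Option H) (Fin K)) F₁
  have hF₂' : ∀ z h t, (F₂.1 *ᵥ z) (h, t) = (F.1 *ᵥ fun t => z (h, t)) t := by
    intro z h t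
    rw [hF₂]
    change (F₁.1 *ᵥ _) (t, h) = _
    rw [hF₁]
    rfl
  -- The second component is a clock in uniform superposition. After `s` rounds of `q` queries, the
  -- branch with clock value `t` has undergone `min s t` applications of `R x`.
  let φ : ℕ → (Fin n → Fin q) → B → ℂ := fun s x b =>
    (Real.sqrt K : ℂ)⁻¹ * ((R x ^ min s (b.2 : ℕ)).1 *ᵥ Pi.single none 1) b.1
  have hφ : ∀ s, Preparable (s * q) fun x => embedState (n := n) (q := q) e (φ s x) := by
    intro s
    induction s with
    | zero =>
      convert (Preparable.init_embedState (n := n) (q := q) e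
        ((none, 0) : B)).unitary_embedState F₂ using 3 with x
      · simp
      · ext ⟨h, t⟩
        rw [hF₂']
        rcases h with _ | h
        · have : (fun t : Fin K => (Pi.single ((none, 0) : B) 1 : B → ℂ) (none, t)) =
              Pi.single 0 1 := by
            ext t; simp [Pi.single_apply, B]
          rw [this, hF]
          simp [φ]
        · have : (fun t : Fin K => (Pi.single ((none, 0) : B) 1 : B → ℂ) (some h, t)) = 0 := by
            ext t; simp [B]
          rw [this]
          simp [φ]
    | succ s ih =>
      obtain ⟨V, hV⟩ := exists_unitary_controlled fun t : Fin K => if s < t then U else 1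
      let d : B → Fin q → ℂ := fun b a => if s < b.2 then
        b.1.elim 1 fun h => if decide (a = (lab h).2.1) = (lab h).2.2 then 1 else -1 else 1
      convert (ih.unitary_embedState V).phase_embedState
        (fun b : B => b.1.elim 0 fun h => (lab h).1) d ?_ using 3 with x
      · ring
      · ext ⟨h, t⟩
        rw [hV]
        by_cases hst : s < (t : ℕ)
        · have h1 : min (s + 1) (t : ℕ) = s + 1 := by omega
          have h2 : (fun h => φ s x (h, t)) = (Real.sqrt K : ℂ)⁻¹ •
              ((R x ^ s).1 *ᵥ Pi.single none 1) := by
            ext h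
            simp only [φ, Pi.smul_apply, smul_eq_mul]
            rw [show min s (t : ℕ) = s by omega]
          have hd : d (h, t) (x (h.elim 0 fun h => (lab h).1)) =
              h.elim 1 fun h => if LabelHolds (lab h) x then 1 else -1 := by
            rcases h with _ | h
            · exact ite_self _
            · exact if_pos hst
          simp only [φ, h1, h2, if_pos hst]
          rw [unitary_pow_succ_mulVec, hR, Matrix.mulVec_smul, hd]
          simp only [Pi.smul_apply, smul_eq_mul]
          ring
        · have h1 : min (s + 1) (t : ℕ) = t := by omega
          have h2 : min s (t : ℕ) = t := by omega
          simp [φ, d, hst, h1, h2]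
      · intro b a
        simp only [d]
        split_ifs
        · rcases b.1 with _ | h
          · simp
          · simp only [Option.elim_some]
            split_ifs <;> simp
        · simp
  obtain ⟨s, V, hV⟩ := (hφ K).unitary_embedState F₂
  let A : QuantumQueryAlgorithm n q :=
    ⟨_, K * q, s, V, fun a => decide ((e.symm a.2.2).2 = 0)⟩
  have hstate : ∀ x, A.state x A.queries = embedState e (F₂.1 *ᵥ φ K x) := fun x => by
    refine Eq.trans ?_ (hV x)
    exact QuantumQueryAlgorithm.state_congr x fun j _ => rfl
  -- The row `0` of `F` is uniform, so the component at clock value `0`, where the algorithm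
  -- accepts, is exactly the average of the iterates.
  have hamp : ∀ x h, (F₂.1 *ᵥ φ K x) (h, 0) =
      iterateAverage (R x) K (Pi.single none 1) h := by
    intro x h
    rw [hF₂', hF', iterateAverage]
    have h1 : ∀ t : Fin K, min K (t : ℕ) = t := fun t => by omega
    have h2 : (K : ℂ)⁻¹ = (Real.sqrt K : ℂ)⁻¹ * (Real.sqrt K : ℂ)⁻¹ := by
      rw [← mul_inv, ← Complex.ofReal_mul, Real.mul_self_sqrt (by positivity)]
      simp
    simp only [φ, h1, ← Finset.mul_sum, Pi.smul_apply, Finset.sum_apply, smul_eq_mul]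
    rw [h2, mul_assoc]
  have htrue : ∀ x, A.answerProb x true =
      ‖WithLp.toLp 2 (iterateAverage (R x) K (Pi.single none 1))‖ ^ 2 := by
    intro x
    rw [QuantumQueryAlgorithm.answerProb, hstate, EuclideanSpace.norm_sq_eq]
    have := sum_embedState (n := n) (q := q) e (F₂.1 *ᵥ φ K x) (fun b => b.2 = 0)
    simp only [A, decide_eq_true_eq]
    refine this.trans ?_
    simp only [B, Fintype.sum_prod_type, Finset.sum_ite_eq', Finset.mem_univ, if_true, hamp]
  refine ⟨A, rfl, fun x => ?_⟩
  have hsum := A.answerProb_true_add_false x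
  rw [htrue] at hsum
  rcases hfx : f x
  · simpa [htrue] using h₀ x hfx
  · have := h₁ x hfx
    simp only [Bool.not_true]
    linarith

/-- With `ψ x = (1, α u x)` and `w y = (1, -α⁻¹ v y)`, feasibility says that `ψ x` is orthogonal to
`w y` when `f x ≠ f y`. Let `U` reflect about the span of the `ψ x` with `f x = true`, and let `D x`
negate the labels that fail for `x`. Then `D x * U` fixes `ψ x` for true `x`, while for false `y` it
makes the start vector a coboundary of `w y`. -/
theorem exists_algorithm_of_hasAdv {f : (Fin n → Fin q) → Bool} {W : ℝ} (hW : 0 ≤ W)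
    (h : HasAdv Set.univ f fun _ => W) {K : ℕ} (hK : 10 * (2 + 3 * W) ≤ K) :
    ∃ A : QuantumQueryAlgorithm n q, A.queries = K * q ∧ A.ComputesWithError f (1 / 10) := by
  classical
  obtain ⟨H, _, lab, u, v, hu, hv, huv, hcu, hcv⟩ := h
  have hKpos : (0 : ℝ) < K := by nlinarith
  -- This `α` gives `‖ψ‖ ^ 2 ≤ 10 / 9`, hence acceptance at least `9 / 10` on true inputs, and still
  -- keeps `‖w‖` linear in `W`.
  obtain ⟨α, hα, hα2⟩ : ∃ α : ℝ, 0 < α ∧ α ^ 2 = 1 / (9 * (W + 1)) :=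
    ⟨Real.sqrt (1 / (9 * (W + 1))), Real.sqrt_pos.2 (by positivity),
      Real.sq_sqrt (by positivity)⟩
  let ψ : (Fin n → Fin q) → Option H → ℂ := fun x h =>
    h.elim 1 fun h => ((α * u x h : ℝ) : ℂ)
  let w : (Fin n → Fin q) → Option H → ℂ := fun x h =>
    h.elim 1 fun h => ((-(α⁻¹ * v x h) : ℝ) : ℂ)
  have hψ : ∀ x, ‖WithLp.toLp 2 (ψ x)‖ ^ 2 ≤ 10 / 9 := by
    intro x
    rw [EuclideanSpace.norm_sq_eq, Fintype.sum_option]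
    simp only [ψ, Option.elim_none, Option.elim_some, Complex.norm_real, Real.norm_eq_abs, sq_abs,
      mul_pow, ← Finset.mul_sum, norm_one]
    have h1 : α ^ 2 * ∑ h, u x h ^ 2 ≤ α ^ 2 * W :=
      mul_le_mul_of_nonneg_left (hcu x trivial) (sq_nonneg α)
    have h2 : α ^ 2 * W ≤ 1 / 9 := by
      rw [hα2, div_mul_eq_mul_div, div_le_div_iff₀ (by positivity) (by positivity)]
      linarith
    linarith
  have hw : ∀ x, ‖WithLp.toLp 2 (w x)‖ ≤ 2 + 3 * W := by
    intro x
    refine abs_le_of_sq_le_sq' ?_ (by positivity) |>.2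
    rw [EuclideanSpace.norm_sq_eq, Fintype.sum_option]
    simp only [w, Option.elim_none, Option.elim_some, Complex.norm_real, Real.norm_eq_abs, sq_abs,
      mul_pow, ← Finset.mul_sum, norm_one, neg_sq]
    have h1 : α⁻¹ ^ 2 * ∑ h, v x h ^ 2 ≤ α⁻¹ ^ 2 * W :=
      mul_le_mul_of_nonneg_left (hcv x trivial) (sq_nonneg _)
    have h2 : α⁻¹ ^ 2 = 9 * (W + 1) := by rw [inv_pow, hα2]; simp
    rw [h2] at h1 ⊢
    nlinarith
  obtain ⟨U, hU₁, hU₂⟩ := exists_unitary_reflection (ψ '' {x | f x = true})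
  have hUw : ∀ y, f y = false → U.1 *ᵥ w y = -w y := by
    intro y hy
    refine hU₂ _ ?_
    rintro _ ⟨x, hx, rfl⟩
    have h1 := huv x trivial y trivial (by rw [hx, hy]; simp)
    simp only [dotProduct, Fintype.sum_option, ψ, w, Option.elim_none, Option.elim_some,
      Pi.star_apply, Complex.star_def, Complex.conj_ofReal, ← Complex.ofReal_mul,
      ← Complex.ofReal_sum]
    have h2 : ∀ h, α * u x h * -(α⁻¹ * v y h) = -(u x h * v y h) := fun h => by
      field_simp
    simp only [h2, Finset.sum_neg_distrib, h1]
    simp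
  have hd : ∀ x : Fin n → Fin q, ∃ D : unitaryGroup (Option H) ℂ, ∀ z, D.1 *ᵥ z = fun h =>
      (h.elim 1 fun h => if LabelHolds (lab h) x then 1 else -1) * z h := by
    refine fun x => exists_unitary_diagonal _ fun h => ?_
    rcases h with _ | h
    · simp
    · simp only [Option.elim_some]
      split_ifs <;> simp
  choose D hD using hd
  have hR : ∀ x z, (D x * U).1 *ᵥ z = fun h =>
      (h.elim 1 fun h => if LabelHolds (lab h) x then 1 else -1) * (U.1 *ᵥ z) h := by
    intro x z
    rw [← hD, Matrix.mulVec_mulVec]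
    rfl
  have hKnat : 0 < K := by exact_mod_cast hKpos
  refine exists_algorithm_of_reflections lab hKnat U (fun x => D x * U) hR ?_ ?_
  · intro x hx
    have h1 : (D x * U).1 *ᵥ ψ x = ψ x := by
      rw [hR, hU₁ _ ⟨x, hx, rfl⟩]
      ext h
      rcases h with _ | h
      · simp [ψ]
      · by_cases hl : LabelHolds (lab h) x
        · simp [hl]
        · simp [ψ, hl, hu x h hl]
    have h2 := norm_star_dotProduct_le_iterateAverage (D x * U) hKnat h1 (Pi.single none 1)
    have h3 : star (ψ x) ⬝ᵥ Pi.single none 1 = 1 := by simp [ψ]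
    rw [h3, norm_one] at h2
    have h4 := hψ x
    set a := ‖WithLp.toLp 2 (ψ x)‖
    set b := ‖WithLp.toLp 2 (iterateAverage (D x * U) K (Pi.single none 1))‖
    have h5 : 1 ≤ a ^ 2 * b ^ 2 := by
      rw [← mul_pow]
      exact one_le_pow₀ h2
    nlinarith [sq_nonneg b]
  · intro y hy
    have h1 : w y - (D y * U).1 *ᵥ w y = (2 : ℂ) • Pi.single none 1 := by
      rw [hR, hUw y hy]
      ext h
      rcases h with _ | h
      · simp [w]; norm_num
      · by_cases hl : LabelHolds (lab h) y
        · simp [w, hl, hv y h hl]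
        · simp [hl]
    have h2 := norm_iterateAverage_le (D y * U) hKnat h1
    have h3 := hw y
    set b := ‖WithLp.toLp 2 (iterateAverage (D y * U) K (Pi.single none 1))‖
    have hb : 0 ≤ b := norm_nonneg _
    have h4 : K * b ≤ K * (1 / 10) := by linarith
    have h5 : b ≤ 1 / 10 := le_of_mul_le_mul_left h4 hKpos
    nlinarith

end Algorithm

/-! ### Concatenations of two palindromes and reflections of a circular word -/

theorem List.exists_eq_append_reverse_iff {α : Type*} (p : List α) :
    (∃ u, p = u ++ u.reverse) ↔ Even p.length ∧ p.reverse = p := by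
  constructor
  · rintro ⟨u, rfl⟩
    simp
  · rintro ⟨⟨m, hm⟩, hp⟩
    refine ⟨p.take m, ?_⟩
    rw [List.reverse_take, hp, hm, Nat.add_sub_cancel, List.take_append_drop]

theorem mem_LREV_iff {α : Type*} (w : List α) :
    w ∈ LREV α ↔ Even w.length ∧ ∃ j, Even j ∧ 0 < j ∧ j < w.length ∧
      (w.take j).reverse = w.take j ∧ (w.drop j).reverse = w.drop j := by
  constructor
  · rintro ⟨u, v, hu, hv, rfl⟩
    have hu' := List.length_pos_iff.2 hu
    have hv' := List.length_pos_iff.2 hv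
    have h : u ++ u.reverse ++ v ++ v.reverse = (u ++ u.reverse) ++ (v ++ v.reverse) := by simp
    refine ⟨⟨u.length + v.length, by simp; omega⟩, u.length + u.length, ⟨_, rfl⟩, by omega,
      by simp; omega, ?_, ?_⟩
    · rw [h, List.take_left' (by simp)]; simp
    · rw [h, List.drop_left' (by simp)]; simp
  · rintro ⟨hw, j, hj, hj0, hjw, h1, h2⟩
    obtain ⟨u, hu⟩ := (List.exists_eq_append_reverse_iff _).2
      ⟨by rwa [List.length_take, min_eq_left hjw.le], h1⟩
    obtain ⟨v, hv⟩ := (List.exists_eq_append_reverse_iff _).2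
      ⟨by rw [List.length_drop]; exact (Nat.even_sub hjw.le).2 (by simp [hw, hj]), h2⟩
    refine ⟨u, v, ?_, ?_, ?_⟩
    · rintro rfl
      have := congrArg List.length hu
      rw [List.length_take, List.reverse_nil, List.append_nil, List.length_nil] at this
      omega
    · rintro rfl
      have := congrArg List.length hv
      rw [List.length_drop, List.reverse_nil, List.append_nil, List.length_nil] at this
      omega
    · rw [← hu, List.append_assoc, ← hv, List.take_append_drop]

section Circular

variable {n q : ℕ} [NeZero n]

/-- The `n`-periodic extension of a word of length `n` to the integers. -/
def circ (x : Fin n → Fin q) (i : ℤ) : Fin q :=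
  x ⟨(i % n).toNat, by
    have h : (0 : ℤ) < n := by exact_mod_cast NeZero.pos n
    have h1 := Int.emod_nonneg i h.ne'
    have h2 := Int.emod_lt_of_pos i h
    omega⟩

theorem circ_eq_of_lt (x : Fin n → Fin q) {i : ℤ} {t : ℕ} (ht : t < n) (h : i % n = t) :
    circ x i = x ⟨t, ht⟩ := by
  simp [circ, h]

theorem circ_natCast (x : Fin n → Fin q) (t : Fin n) : circ x (t : ℕ) = x t :=
  circ_eq_of_lt x t.2 (Int.emod_eq_of_lt (by omega) (by have := t.2; omega))

theorem circ_congr (x : Fin n → Fin q) {i j : ℤ} (h : i % n = j % n) : circ x i = circ x j := by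
  simp [circ, h]

theorem circ_periodic (x : Fin n → Fin q) : Function.Periodic (circ x) (n : ℤ) :=
  fun i => circ_congr x (by simp)

theorem exists_circ_pos (i : ℤ) : ∃ t : Fin n, ∀ x : Fin n → Fin q, circ x i = x t :=
  ⟨_, fun _ => rfl⟩

/-- Modulo `n`, the reflection `i ↦ j - 1 - i` preserves the prefix of length `j` and the remaining
suffix and reverses each of them, so one symmetry of the circular word expresses both palindromes.
-/
theorem REV_eq_true_iff (x : Fin n → Fin q) :
    REV x = true ↔ Even n ∧ ∃ j : ℕ, Even j ∧ 0 < j ∧ j < n ∧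
      ∀ i : ℤ, circ x (j - 1 - i) = circ x i := by
  classical
  rw [REV, decide_eq_true_iff, mem_LREV_iff, List.length_ofFn]
  refine and_congr_right fun _ => exists_congr fun j => and_congr_right fun _ =>
    and_congr_right fun _ => and_congr_right fun hj => ?_
  constructor
  · rintro ⟨h1, h2⟩ i
    have hn : (0 : ℤ) < n := by exact_mod_cast NeZero.pos n
    have hi1 := Int.emod_nonneg i hn.ne'
    have hi2 := Int.emod_lt_of_pos i hn
    obtain ⟨t, ht⟩ := Int.eq_ofNat_of_zero_le hi1
    have htn : t < n := by omega
    have hr : ((j : ℤ) - 1 - i) % n = ((j : ℤ) - 1 - t) % n := by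
      rw [← ht, Int.sub_emod_emod]
    rw [circ_eq_of_lt x htn ht]
    rcases lt_or_ge t j with htj | htj
    · rw [circ_eq_of_lt x (t := j - 1 - t) (by omega)
        (by rw [hr, Int.emod_eq_of_lt] <;> omega)]
      have := List.getElem_of_eq h1 (i := t) (by simp; omega)
      simp only [List.getElem_reverse, List.getElem_take, List.getElem_ofFn, List.length_take,
        List.length_ofFn, min_eq_left hj.le] at this
      exact this
    · have hr' : ((j : ℤ) - 1 - t) % n = ((j : ℤ) - 1 - t + n) % n := by simp
      rw [circ_eq_of_lt x (t := n + j - 1 - t) (by omega)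
        (by rw [hr, hr', Int.emod_eq_of_lt] <;> omega)]
      have := List.getElem_of_eq h2 (i := t - j) (by simp; omega)
      simp only [List.getElem_reverse, List.getElem_drop, List.getElem_ofFn, List.length_drop,
        List.length_ofFn] at this
      convert this using 3 <;> omega
  · intro h
    constructor
    · refine List.ext_getElem (by simp) fun t h1 h2 => ?_
      simp only [List.length_take, List.length_ofFn] at h2
      simp only [List.getElem_reverse, List.getElem_take, List.getElem_ofFn, List.length_take,
        List.length_ofFn, min_eq_left hj.le]
      rw [← circ_natCast x, ← circ_natCast x]
      convert h t using 2
      simp; omega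
    · refine List.ext_getElem (by simp) fun t h1 h2 => ?_
      simp only [List.length_drop, List.length_ofFn] at h2
      simp only [List.getElem_reverse, List.getElem_drop, List.getElem_ofFn, List.length_drop,
        List.length_ofFn]
      rw [← circ_natCast x, ← circ_natCast x, ← h, ← circ_periodic]
      congr 1
      simp
      omega

end Circular

/-! ### A dual adversary solution for `REV` -/

section Potential

/-- The potential of a search state with `k` sample columns and `m` live shifts. -/
noncomputable def shiftPotential (k m : ℕ) : ℝ :=
  k * Real.logb 2 m + Real.logb 2 m ^ 2 + 2 * (k + Real.logb 2 m + 1)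

theorem logb_two_natCast_nonneg (m : ℕ) : 0 ≤ Real.logb 2 m := by
  rcases Nat.eq_zero_or_pos m with rfl | hm
  · simp
  · exact Real.logb_nonneg (by norm_num) (by exact_mod_cast hm)

theorem logb_two_add_one_le {a m : ℕ} (ha : 1 ≤ a) (h : 2 * a ≤ m) :
    Real.logb 2 a + 1 ≤ Real.logb 2 m := by
  have ha' : (0 : ℝ) < a := by exact_mod_cast ha
  have h1 : Real.logb 2 ((2 : ℝ) * a) = 1 + Real.logb 2 a := by
    rw [Real.logb_mul (by norm_num) ha'.ne', Real.logb_self_eq_one (by norm_num)]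
  rw [add_comm, ← h1]
  exact Real.logb_le_logb_of_le (by norm_num) (by positivity) (by exact_mod_cast h)

/-- The reserve that pays for the last round, once a single shift is live. -/
theorem two_mul_le_shiftPotential (k m : ℕ) : 2 * ((k : ℝ) + 1) ≤ shiftPotential k m := by
  have := logb_two_natCast_nonneg m
  have : 0 ≤ (k : ℝ) * Real.logb 2 m := by positivity
  unfold shiftPotential
  nlinarith

theorem shiftPotential_half {k a m : ℕ} (ha : 1 ≤ a) (h : 2 * a ≤ m) :
    (k : ℝ) + 1 + shiftPotential k a ≤ shiftPotential k m := by
  have h1 := logb_two_add_one_le ha h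
  have h2 := logb_two_natCast_nonneg a
  have h3 : (0 : ℝ) ≤ k := by positivity
  unfold shiftPotential
  nlinarith [mul_le_mul_of_nonneg_left h1 h3]

/-- By AM-GM, `4 * a * b ≤ m ^ 2`, so the two logarithms average at most `logb 2 m - 1`. This drop
pays for the round and for the additional column. -/
theorem shiftPotential_branch {k a b m : ℕ} (ha : 1 ≤ a) (hb : 1 ≤ b) (h : a + b ≤ m) :
    (k : ℝ) + 1 + (shiftPotential (k + 1) a + shiftPotential (k + 1) b) / 2 ≤
      shiftPotential k m := by
  have ha' : (0 : ℝ) < a := by exact_mod_cast ha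
  have hb' : (0 : ℝ) < b := by exact_mod_cast hb
  have hm' : (0 : ℝ) < m := by exact_mod_cast (by omega : 0 < m)
  have hab : (a : ℝ) + b ≤ m := by exact_mod_cast h
  have h1 : Real.logb 2 a + Real.logb 2 b + 2 ≤ 2 * Real.logb 2 m := by
    have e1 : Real.logb 2 ((a : ℝ) * b * 4) = Real.logb 2 a + Real.logb 2 b + 2 := by
      rw [Real.logb_mul (by positivity) (by norm_num), Real.logb_mul ha'.ne' hb'.ne']
      rw [show (4 : ℝ) = 2 ^ (2 : ℝ) by norm_num, Real.logb_rpow (by norm_num) (by norm_num)]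
    have e2 : Real.logb 2 ((m : ℝ) * m) = 2 * Real.logb 2 m := by
      rw [Real.logb_mul hm'.ne' hm'.ne']; ring
    rw [← e1, ← e2]
    refine Real.logb_le_logb_of_le (by norm_num) (by positivity) ?_
    nlinarith [sq_nonneg ((a : ℝ) - b)]
  have h2 : Real.logb 2 a ≤ Real.logb 2 m :=
    Real.logb_le_logb_of_le (by norm_num) ha' (by linarith)
  have h3 : Real.logb 2 b ≤ Real.logb 2 m :=
    Real.logb_le_logb_of_le (by norm_num) hb' (by linarith)
  have h4 := logb_two_natCast_nonneg a
  have h5 := logb_two_natCast_nonneg b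
  have h6 := logb_two_natCast_nonneg m
  have hk : (0 : ℝ) ≤ k := by positivity
  unfold shiftPotential
  push_cast
  generalize Real.logb 2 a = x at *
  generalize Real.logb 2 b = y at *
  generalize Real.logb 2 m = z at *
  have h7 : x ^ 2 ≤ z * x := by nlinarith
  have h8 : y ^ 2 ≤ z * y := by nlinarith
  have h9 : z * (x + y + 2) ≤ z * (2 * z) := mul_le_mul_of_nonneg_left h1 h6
  have h10 : (k : ℝ) * (x + y + 2) ≤ k * (2 * z) := mul_le_mul_of_nonneg_left h1 hk
  nlinarith

end Potential

/-! ### Live shifts, periods and the search for a reflection -/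

section Shifts

variable {n q : ℕ} [NeZero n]

/-- The shifts `t < d` at which the word `circ x` looks as at `s` in the sample columns. -/
def liveShifts (d s : ℕ) (cols : List ℕ) (x : Fin n → Fin q) : Finset ℕ :=
  (Finset.range d).filter fun t => ∀ c ∈ cols, circ x (t + c) = circ x (s + c)

theorem mem_liveShifts {d s : ℕ} {cols : List ℕ} {x : Fin n → Fin q} {t : ℕ} :
    t ∈ liveShifts d s cols x ↔ t < d ∧ ∀ c ∈ cols, circ x (t + c) = circ x (s + c) := by
  simp [liveShifts]

theorem card_liveShifts_pos {d s : ℕ} (cols : List ℕ) (x : Fin n → Fin q) (hs : s < d) :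
    1 ≤ (liveShifts d s cols x).card :=
  Finset.card_pos.2 ⟨s, mem_liveShifts.2 ⟨hs, fun _ _ => rfl⟩⟩

/-- A shift cannot agree with both `s` and `t` in a column where these differ, so the two refined
sets are disjoint. -/
theorem card_liveShifts_cons_add_le {d s t : ℕ} {cols : List ℕ} {x : Fin n → Fin q} {c : ℕ}
    (ht : t ∈ liveShifts d s cols x) (hc : circ x (s + c) ≠ circ x (t + c)) :
    (liveShifts d s (c :: cols) x).card + (liveShifts d t (c :: cols) x).card ≤
      (liveShifts d s cols x).card := by
  rw [← Finset.card_union_of_disjoint]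
  · refine Finset.card_le_card (Finset.union_subset (fun a ha => ?_) fun a ha => ?_)
    · rw [mem_liveShifts] at ha ⊢
      exact ⟨ha.1, fun b hb => ha.2 b (by simp [hb])⟩
    · rw [mem_liveShifts] at ha ht ⊢
      exact ⟨ha.1, fun b hb => (ha.2 b (by simp [hb])).trans (ht.2 b hb)⟩
  · rw [Finset.disjoint_left]
    intro a ha hb
    rw [mem_liveShifts] at ha hb
    exact hc ((ha.2 c (by simp)).symm.trans (hb.2 c (by simp)))

theorem Function.Periodic.of_int_dvd {α : Type*} {f : ℤ → α} {d e : ℤ} (h : Function.Periodic f d)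
    (hd : d ∣ e) : Function.Periodic f e := by
  obtain ⟨k, rfl⟩ := hd
  rw [mul_comm]
  exact h.int_mul k

theorem Function.Periodic.nat_gcd {α : Type*} {f : ℤ → α} {d e : ℕ} (hd : Function.Periodic f d)
    (he : Function.Periodic f e) : Function.Periodic f (Nat.gcd d e : ℕ) := by
  rw [Nat.gcd_eq_gcd_ab]
  exact (hd.of_int_dvd (dvd_mul_right _ _)).add_period (he.of_int_dvd (dvd_mul_right _ _))

theorem Function.Periodic.apply_eq_of_dvd_sub {α : Type*} {f : ℤ → α} {d i j : ℤ}
    (h : Function.Periodic f d) (hd : d ∣ i - j) : f i = f j := by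
  have := h.of_int_dvd hd j
  rwa [add_sub_cancel] at this

/-- Each live shift `t < d'` produces two below `d`, namely `t` and `t + d'`. -/
theorem two_mul_card_liveShifts_le {d d' s : ℕ} {cols : List ℕ} {x : Fin n → Fin q}
    (h : Function.Periodic (circ x) (d' : ℤ)) (hd : 2 * d' ≤ d) :
    2 * (liveShifts d' (s % d') cols x).card ≤ (liveShifts d s cols x).card := by
  have hs : ∀ c : ℕ, circ x ((s % d' : ℕ) + c) = circ x (s + c) := fun c => by
    refine h.apply_eq_of_dvd_sub ?_
    rw [add_sub_add_right_eq_sub]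
    push_cast
    exact (Int.mod_modEq _ _).symm.dvd
  set A := liveShifts d' (s % d') cols x
  have hA : ∀ t ∈ A, t < d' ∧ ∀ c ∈ cols, circ x (t + c) = circ x (s + c) := by
    intro t ht
    rw [mem_liveShifts] at ht
    exact ⟨ht.1, fun c hc => (ht.2 c hc).trans (hs c)⟩
  have hmap : (A.map (addRightEmbedding d')).card = A.card := Finset.card_map _
  rw [two_mul]
  nth_rewrite 2 [← hmap]
  rw [← Finset.card_union_of_disjoint]
  · refine Finset.card_le_card (Finset.union_subset (fun t ht => ?_) fun t ht => ?_)
    · obtain ⟨h1, h2⟩ := hA t ht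
      exact mem_liveShifts.2 ⟨by omega, h2⟩
    · obtain ⟨a, ha, rfl⟩ := Finset.mem_map.1 ht
      obtain ⟨h1, h2⟩ := hA a ha
      refine mem_liveShifts.2 ⟨by simp; omega, fun c hc => ?_⟩
      rw [← h2 c hc, addRightEmbedding_apply]
      push_cast
      rw [add_right_comm, h]
  · rw [Finset.disjoint_left]
    intro t ht ht'
    obtain ⟨a, ha, rfl⟩ := Finset.mem_map.1 ht'
    have := (hA _ ht).1
    simp at this

/-- If only one shift is live, then all reflections of the word agree modulo its period. -/
theorem dvd_sub_of_reflection {d s j₀ : ℕ} {cols : List ℕ} {x : Fin n → Fin q} {j : ℤ}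
    (hd : Function.Periodic (circ x) (d : ℤ)) (hs : s < d)
    (h : ∀ t ∈ liveShifts d s cols x, t = s)
    (h₀ : ∀ c ∈ cols, circ x (j₀ - (s + c)) = circ x (s + c))
    (hj : ∀ i, circ x (j - i) = circ x i) : (d : ℤ) ∣ j - j₀ := by
  have hd0 : (0 : ℤ) < d := by omega
  have h1 := Int.emod_nonneg (j - j₀ + s) hd0.ne'
  have h2 := Int.emod_lt_of_pos (j - j₀ + s) hd0
  obtain ⟨t, ht⟩ := Int.eq_ofNat_of_zero_le h1
  have h3 : (d : ℤ) ∣ (j - j₀ + s) - t := by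
    rw [← ht]; exact Int.dvd_self_sub_emod
  -- Composing the reflection `j` with the sampled agreement at `j₀` shows that the shift by `j - j₀
  -- + s`, reduced modulo `d`, looks like `s` in all columns, so it is live.
  have hts : t = s := by
    refine h t (mem_liveShifts.2 ⟨by omega, fun c hc => ?_⟩)
    rw [← h₀ c hc, ← hj (j₀ - (s + c))]
    refine hd.apply_eq_of_dvd_sub ?_
    obtain ⟨k, hk⟩ := h3
    exact ⟨-k, by linear_combination -hk⟩
  subst hts
  obtain ⟨k, hk⟩ := h3
  exact ⟨k, by linear_combination hk⟩

namespace HasAdv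

variable {D : Set (Fin n → Fin q)}

theorem circ_eq_test (i j : ℤ) :
    HasAdv D (fun x => decide (circ x i = circ x j)) fun _ => eqCost q := by
  obtain ⟨a, ha⟩ := exists_circ_pos (n := n) (q := q) i
  obtain ⟨b, hb⟩ := exists_circ_pos (n := n) (q := q) j
  simpa only [ha, hb] using eq_test a b

theorem circ_forall_test (cols : List ℕ) (F G : ℕ → ℤ) :
    HasAdv D (fun x => decide (∀ c ∈ cols, circ x (F c) = circ x (G c)))
      fun _ => 2 * eqCost q * (cols.length + 1) := by
  refine (forall_mem (eqCost_pos q).le cols fun c => circ_eq_test (F c) (G c)).mono subset_rfl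
    (fun _ _ => rfl) fun _ _ => ?_
  have h1 : Real.sqrt ((cols.length : ℝ) + 1) ≤ cols.length + 1 :=
    Real.sqrt_le_iff.2 ⟨by positivity, by nlinarith⟩
  nlinarith [eqCost_pos q]

end HasAdv

/-- The cost of a search over the positions for a mismatch of two input symbols, doubled. -/
noncomputable def scanCost (n q : ℕ) : ℝ := 4 * HasAdv.eqCost q * Real.sqrt (n + 1)

theorem scanCost_pos (n q : ℕ) : 0 < scanCost n q := by
  have := HasAdv.eqCost_pos q
  unfold scanCost
  positivity


namespace HasAdv

variable {D : Set (Fin n → Fin q)} {f : (Fin n → Fin q) → Bool} {c : (Fin n → Fin q) → ℝ}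

theorem search_mismatch (F G : ℕ → ℤ) {m : ℕ} (hm : m ≤ n)
    (ht : ∀ a < m, HasAdv {x ∈ D | circ x (F a) ≠ circ x (G a)} f c)
    (hn : HasAdv {x ∈ D | ∀ a < m, circ x (F a) = circ x (G a)} f c) :
    HasAdv D f fun x => c x + scanCost n q / 2 := by
  refine (search (p := fun a x => !decide (circ x (F a) = circ x (G a))) (m := n)
    (eqCost_pos q).le (l := List.range m) (by simpa using hm) (fun a _ => (circ_eq_test _ _).not)
    (fun a ha => (ht a (List.mem_range.1 ha)).mono (fun x hx => ?_) (fun _ _ => rfl)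
      fun _ _ => le_rfl)
    (hn.mono (fun x hx => ?_) (fun _ _ => rfl) fun _ _ => le_rfl)).mono subset_rfl
    (fun _ _ => rfl) fun x _ => ?_
  · exact ⟨hx.1, by simpa using hx.2⟩
  · exact ⟨hx.1, by simpa using hx.2⟩
  · unfold scanCost
    linarith

theorem search_sample (l : List ℕ) (hl : l.length ≤ n) (cols : List ℕ) (F : ℕ → ℕ → ℤ)
    (G : ℕ → ℤ)
    (ht : ∀ a ∈ l, HasAdv {x ∈ D | ∀ b ∈ cols, circ x (F a b) = circ x (G b)} f c)
    (hn : HasAdv {x ∈ D | ∀ a ∈ l, ¬ ∀ b ∈ cols, circ x (F a b) = circ x (G b)} f c) :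
    HasAdv D f fun x => c x + scanCost n q * (cols.length + 1) := by
  have hκ : 0 ≤ 2 * eqCost q * ((cols.length : ℝ) + 1) := by
    have := eqCost_pos q
    positivity
  refine (search (p := fun a x => decide (∀ b ∈ cols, circ x (F a b) = circ x (G b))) hκ hl
    (fun a _ => circ_forall_test cols _ _)
    (fun a ha => (ht a ha).mono (fun x hx => ?_) (fun _ _ => rfl) fun _ _ => le_rfl)
    (hn.mono (fun x hx => ?_) (fun _ _ => rfl) fun _ _ => le_rfl)).mono subset_rfl
    (fun _ _ => rfl) fun x _ => ?_
  · exact ⟨hx.1, of_decide_eq_true hx.2⟩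
  · exact ⟨hx.1, fun a ha => of_decide_eq_false (hx.2 a ha)⟩
  · unfold scanCost
    linarith

/-- A sample search finds a candidate centre `j₀ < d`; a true reflection, reduced modulo `d`, would
pass it. As all reflections are congruent to `j₀`, a mismatch at `j₀` refutes them all. -/
theorem REV_of_unique_shift {d s : ℕ} (cols : List ℕ) (hd : d ≤ n) (hs : s < d) :
    HasAdv {x : Fin n → Fin q | Function.Periodic (circ x) (d : ℤ) ∧
      ∀ t ∈ liveShifts d s cols x, t = s} REV
      fun _ => scanCost n q / 2 + scanCost n q * (cols.length + 1) := by
  have hU := scanCost_pos n q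
  refine search_sample (List.range d) (by simpa using hd) cols (fun a b => a - (s + b))
    (fun b => s + b) (c := fun _ => scanCost n q / 2) (fun j₀ _ => ?_) ?_
  · refine (search_mismatch (fun a => (j₀ - a : ℤ)) (fun a => (a : ℤ)) le_rfl
      (c := fun _ => 0) (fun a _ => ?_) ?_).mono subset_rfl (fun _ _ => rfl) fun _ _ => by simp
    · refine const (b := false) (fun x hx => ?_) fun _ _ => le_rfl
      obtain ⟨⟨⟨hper, huniq⟩, hj₀⟩, hne⟩ := hx
      rw [Bool.eq_false_iff, ne_eq, REV_eq_true_iff]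
      rintro ⟨_, j, _, _, _, hj⟩
      refine hne ((hper.apply_eq_of_dvd_sub ?_).trans (hj a))
      obtain ⟨k, hk⟩ := dvd_sub_of_reflection hper hs huniq hj₀ hj
      exact ⟨-k, by linear_combination -hk⟩
    · classical
      -- With `j₀` verified, the reflections are exactly the numbers congruent to `j₀` modulo `d`,
      -- and the answer no longer depends on `x`.
      refine const (b := decide (Even n ∧ ∃ j : ℕ, Even j ∧ 0 < j ∧ j < n ∧
        (d : ℤ) ∣ j - 1 - j₀)) (fun x hx => ?_) fun _ _ => le_rfl
      obtain ⟨⟨⟨hper, huniq⟩, hj₀⟩, hall⟩ := hx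
      have hall' : ∀ i : ℤ, circ x (j₀ - i) = circ x i := by
        intro i
        have hn : (0 : ℤ) < n := by exact_mod_cast NeZero.pos n
        have h1 := Int.emod_nonneg i hn.ne'
        have h2 := Int.emod_lt_of_pos i hn
        obtain ⟨t, ht⟩ := Int.eq_ofNat_of_zero_le h1
        have h3 := hall t (by omega)
        rw [← ht] at h3
        rw [circ_congr x (i := j₀ - i) (j := j₀ - i % n) (by simp), h3]
        exact circ_congr x (by simp)
      rw [Bool.eq_iff_iff, REV_eq_true_iff, decide_eq_true_iff]
      refine and_congr_right fun _ => exists_congr fun j => and_congr_right fun _ =>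
        and_congr_right fun _ => and_congr_right fun _ => ⟨fun hj => ?_, fun hj i => ?_⟩
      · exact dvd_sub_of_reflection hper hs huniq hj₀ hj
      · rw [← hall' i]
        refine hper.apply_eq_of_dvd_sub ?_
        obtain ⟨k, hk⟩ := hj
        exact ⟨k, by linear_combination hk⟩
  · refine const (b := false) (fun x hx => ?_) fun _ _ => by positivity
    obtain ⟨⟨hper, huniq⟩, hnone⟩ := hx
    rw [Bool.eq_false_iff, ne_eq, REV_eq_true_iff]
    rintro ⟨_, j, _, _, _, hj⟩
    have hd0 : (0 : ℤ) < d := by omega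
    have h1 := Int.emod_nonneg (j - 1 : ℤ) hd0.ne'
    have h2 := Int.emod_lt_of_pos (j - 1 : ℤ) hd0
    obtain ⟨t, ht⟩ := Int.eq_ofNat_of_zero_le h1
    refine hnone t (List.mem_range.2 (by omega)) fun b _ => ?_
    rw [← hj (s + b)]
    refine hper.apply_eq_of_dvd_sub ?_
    obtain ⟨k, hk⟩ : (d : ℤ) ∣ (j - 1) - t := by
      rw [← Int.ofNat_eq_natCast, ← ht]; exact Int.dvd_self_sub_emod
    exact ⟨-k, by linear_combination -hk⟩

/-- Induction on a bound for the number of live shifts. A round spends `scanCost * (k + 1)` on the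
search for another live shift and `scanCost / 2` on the search for a mismatch, which `2 * scanCost *
(k + 1)` covers; this is what the potential releases. -/
theorem REV_of_liveShifts (M : ℕ) : ∀ {d s : ℕ} (cols : List ℕ), d ≤ n → s < d →
    HasAdv {x : Fin n → Fin q | Function.Periodic (circ x) (d : ℤ) ∧
      (liveShifts d s cols x).card ≤ M} REV
      fun x => 2 * scanCost n q * shiftPotential cols.length (liveShifts d s cols x).card := by
  have hU := scanCost_pos n q
  induction M with
  | zero =>
    intro d s cols _ hs
    have h : ∀ x : Fin n → Fin q, ¬ (liveShifts d s cols x).card ≤ 0 := fun x => by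
      have := card_liveShifts_pos cols x hs
      omega
    exact const (b := true) (fun x hx => absurd hx.2 (h x)) fun x hx => absurd hx.2 (h x)
  | succ M ih =>
    intro d s cols hd hs
    set P : (Fin n → Fin q) → ℝ := fun x =>
      2 * scanCost n q * shiftPotential cols.length (liveShifts d s cols x).card with hP
    have hk : ∀ x, P x = (P x - scanCost n q * (cols.length + 1)) +
      scanCost n q * (cols.length + 1) := fun x => by ring
    refine (search_sample ((List.range d).filter (· ≠ s)) ?_ cols (fun a b => a + b)
      (fun b => s + b) (c := fun x => P x - scanCost n q * (cols.length + 1))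
      (fun t ht => ?_) ?_).mono subset_rfl (fun _ _ => rfl) fun x _ => (hk x).ge
    · exact (List.length_filter_le _ _).trans (by simpa using hd)
    · simp only [List.mem_filter, List.mem_range, ne_eq, decide_not, Bool.not_eq_true',
        decide_eq_false_iff_not] at ht
      obtain ⟨htd, hts⟩ := ht
      refine (search_mismatch (fun a => (s + a : ℤ)) (fun a => (t + a : ℤ)) le_rfl
        (c := fun x => P x - 2 * scanCost n q * (cols.length + 1))
        (fun a _ => ?_) ?_).mono subset_rfl (fun _ _ => rfl) fun x _ => ?_
      · let E : Set (Fin n → Fin q) := {x | (Function.Periodic (circ x) (d : ℤ) ∧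
          (liveShifts d s cols x).card ≤ M + 1) ∧ t ∈ liveShifts d s cols x ∧
          circ x (s + a) ≠ circ x (t + a)}
        have h1 := fun x (hx : x ∈ E) => card_liveShifts_cons_add_le hx.2.1 hx.2.2
        have h2 := fun x : Fin n → Fin q => card_liveShifts_pos (a :: cols) x hs
        have h3 := fun x : Fin n → Fin q => card_liveShifts_pos (a :: cols) x htd
        have h4 := ((ih (a :: cols) hd hs).mono (D' := E)
          -- Both parts of the split are nonempty, as they contain `s` and `t`; hence each is
          -- smaller than the whole and the induction applies.
          (fun x hx => ⟨hx.1.1, by have := h1 x hx; have := h3 x; have := hx.1.2; omega⟩)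
          (fun _ _ => rfl) fun _ _ => le_rfl).coin ((ih (a :: cols) hd htd).mono (D' := E)
          (fun x hx => ⟨hx.1.1, by have := h1 x hx; have := h2 x; have := hx.1.2; omega⟩)
          (fun _ _ => rfl) fun _ _ => le_rfl)
        refine h4.mono (fun x hx => ⟨hx.1.1, mem_liveShifts.2 ⟨htd, hx.1.2⟩, hx.2⟩)
          (fun _ _ => rfl) fun x hx => ?_
        have h5 := shiftPotential_branch (k := cols.length) (h2 x) (h3 x)
          (h1 x ⟨hx.1.1, mem_liveShifts.2 ⟨htd, hx.1.2⟩, hx.2⟩)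
        have h6 := mul_le_mul_of_nonneg_left h5 (by positivity : 0 ≤ 2 * scanCost n q)
        simp only [List.length_cons]
        rw [hP]
        linarith
      -- Equal rotations make `e = |t - s|` a period. Then `gcd d e` is a period and a proper
      -- divisor of `d`, hence at most `d / 2`.
      · obtain ⟨e, he0, hed, he⟩ : ∃ e : ℕ, 0 < e ∧ e < d ∧ ((e : ℤ) = t - s ∨ (e : ℤ) = s - t) :=
          ⟨(t - s) + (s - t), by omega, by omega, by omega⟩
        have hg0 : 0 < Nat.gcd d e := Nat.gcd_pos_of_pos_right _ he0
        have hge : Nat.gcd d e ≤ e := Nat.gcd_le_right _ he0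
        have hgd : 2 * Nat.gcd d e ≤ d := by
          obtain ⟨k, hk⟩ := Nat.gcd_dvd_left d e
          have : 2 ≤ k := by
            by_contra! hk2
            interval_cases k <;> omega
          calc 2 * Nat.gcd d e ≤ k * Nat.gcd d e := Nat.mul_le_mul_right _ this
            _ = d := by rw [mul_comm, ← hk]
        have hper : ∀ x : Fin n → Fin q, (∀ a < n, circ x (s + a) = circ x (t + a)) →
            Function.Periodic (circ x) (e : ℤ) := by
          intro x hx
          have hx' : ∀ i : ℤ, circ x (s + i) = circ x (t + i) := by
            intro i
            have hn : (0 : ℤ) < n := by exact_mod_cast NeZero.pos n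
            have h1 := Int.emod_nonneg i hn.ne'
            have h2 := Int.emod_lt_of_pos i hn
            obtain ⟨u, hu⟩ := Int.eq_ofNat_of_zero_le h1
            have h3 := hx u (by omega)
            rw [← hu] at h3
            rw [circ_congr x (i := s + i) (j := s + i % n) (by simp), h3]
            exact circ_congr x (by simp)
          intro i
          rcases he with he | he
          · rw [he, show i + ((t : ℤ) - s) = t + (i - s) by ring, ← hx', add_sub_cancel]
          · rw [he, show i + ((s : ℤ) - t) = s + (i - t) by ring, hx', add_sub_cancel]
        refine (ih cols (d := Nat.gcd d e) (s := s % Nat.gcd d e) (by omega)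
          (Nat.mod_lt _ hg0)).mono (fun x hx => ?_) (fun _ _ => rfl) fun x hx => ?_
        all_goals
          obtain ⟨⟨⟨hd', hM⟩, _⟩, hst⟩ := hx
          have hgp := hd'.nat_gcd (hper x hst)
          have h1 := two_mul_card_liveShifts_le (s := s) (cols := cols) hgp hgd
          have h2 := card_liveShifts_pos cols x (Nat.mod_lt s hg0)
        · exact ⟨hgp, by omega⟩
        · have h5 := shiftPotential_half (k := cols.length) h2 h1
          have h6 := mul_le_mul_of_nonneg_left h5 (by positivity : 0 ≤ 2 * scanCost n q)
          rw [hP]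
          linarith
      · have : 0 ≤ scanCost n q * cols.length := by positivity
        linarith
    · refine (REV_of_unique_shift cols hd hs).mono (fun x hx => ⟨hx.1.1, fun t ht => ?_⟩)
        (fun _ _ => rfl) fun x _ => ?_
      · by_contra hts
        rw [mem_liveShifts] at ht
        exact hx.2 t (by simpa using ⟨ht.1, hts⟩) ht.2
      · have h5 := two_mul_le_shiftPotential cols.length (liveShifts d s cols x).card
        have h6 := mul_le_mul_of_nonneg_left h5 (by positivity : 0 ≤ 2 * scanCost n q)
        have : 0 ≤ scanCost n q * cols.length := by positivity
        rw [hP]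
        linarith

end HasAdv

end Shifts

/-! ### The quantum query bound -/

section QuantumBound

variable {n q : ℕ}

theorem HasAdv.REV_univ [NeZero n] :
    HasAdv Set.univ (REV : (Fin n → Fin q) → Bool)
      fun _ => 2 * scanCost n q * shiftPotential 0 n := by
  have h : ∀ x : Fin n → Fin q, (liveShifts n 0 [] x).card = n := fun x => by simp [liveShifts]
  refine (HasAdv.REV_of_liveShifts n [] le_rfl (NeZero.pos n)).mono
    (fun x _ => ⟨circ_periodic x, (h x).le⟩) (fun _ _ => rfl) fun x _ => ?_
  rw [h]
  rfl

theorem scanCost_mul_shiftPotential_le (hn : 2 ≤ n) :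
    2 * scanCost n q * shiftPotential 0 n ≤
      80 * HasAdv.eqCost q * (Real.sqrt n * Real.logb 2 n ^ 2) := by
  have hn' : (2 : ℝ) ≤ n := by exact_mod_cast hn
  have hL : 1 ≤ Real.logb 2 n := by
    rw [Real.le_logb_iff_rpow_le (by norm_num) (by linarith)]
    simpa using hn'
  have h1 : shiftPotential 0 n ≤ 5 * Real.logb 2 n ^ 2 := by
    unfold shiftPotential
    push_cast
    nlinarith
  have h2 : Real.sqrt ((n : ℝ) + 1) ≤ 2 * Real.sqrt n := by
    rw [Real.sqrt_le_left (by positivity), mul_pow, Real.sq_sqrt (by positivity)]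
    linarith
  have h3 := HasAdv.eqCost_pos q
  have h4 : 2 * scanCost n q ≤ 16 * HasAdv.eqCost q * Real.sqrt n := by
    unfold scanCost
    nlinarith
  calc 2 * scanCost n q * shiftPotential 0 n
      ≤ 16 * HasAdv.eqCost q * Real.sqrt n * (5 * Real.logb 2 n ^ 2) :=
        mul_le_mul h4 h1 (le_trans (by positivity) (two_mul_le_shiftPotential 0 n))
          (by positivity)
    _ = _ := by ring

theorem exists_algorithm_REV [NeZero q] (hn : 2 ≤ n) :
    ∃ A : QuantumQueryAlgorithm n q,
      (A.queries : ℝ) ≤ q * (21 + 2400 * HasAdv.eqCost q) / Real.log 2 ^ 2 *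
        (Real.sqrt n * Real.log n ^ 2) ∧ A.ComputesWithError REV (1 / 10) := by
  have : NeZero n := ⟨by omega⟩
  set W : ℝ := 2 * scanCost n q * shiftPotential 0 n with hWdef
  have hW : 0 ≤ W := by
    have h1 := scanCost_pos n q
    have h2 : 0 ≤ shiftPotential 0 n := le_trans (by positivity) (two_mul_le_shiftPotential 0 n)
    positivity
  obtain ⟨A, hA, hA'⟩ := exists_algorithm_of_hasAdv hW HasAdv.REV_univ
    (Nat.le_ceil (10 * (2 + 3 * W)))
  refine ⟨A, ?_, hA'⟩
  -- `K ≤ 21 + 30 * W` and `W ≤ 80 * eqCost q * (√n * logb 2 n ^ 2)` give the constants 21 and 2400.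
  have h1 := (Nat.ceil_lt_add_one (by positivity : 0 ≤ 10 * (2 + 3 * W))).le
  have h2 : W ≤ _ := scanCost_mul_shiftPotential_le (q := q) hn
  have hn' : (2 : ℝ) ≤ n := by exact_mod_cast hn
  have hL : 1 ≤ Real.logb 2 n := by
    rw [Real.le_logb_iff_rpow_le (by norm_num) (by linarith)]
    simpa using hn'
  have h3 : 1 ≤ Real.sqrt n * Real.logb 2 n ^ 2 :=
    one_le_mul_of_one_le_of_one_le (Real.one_le_sqrt.2 (by linarith)) (one_le_pow₀ hL)
  have h4 : q * (21 + 2400 * HasAdv.eqCost q) / Real.log 2 ^ 2 *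
      (Real.sqrt n * Real.log n ^ 2) =
      q * ((21 + 2400 * HasAdv.eqCost q) * (Real.sqrt n * Real.logb 2 n ^ 2)) := by
    rw [Real.logb]
    ring
  rw [hA, h4, Nat.cast_mul, mul_comm]
  refine mul_le_mul_of_nonneg_left ?_ (Nat.cast_nonneg q)
  linarith

theorem exists_algorithm_REV_of_odd [NeZero q] (hn : 0 < n) (ho : ¬ Even n) {ε : ℝ} (hε : 0 ≤ ε) :
    ∃ A : QuantumQueryAlgorithm n q, A.queries = 0 ∧ A.ComputesWithError REV ε := by
  have : NeZero n := ⟨hn.ne'⟩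
  refine ⟨⟨1, 0, (0, 0, 0), fun _ => 1, fun _ => false⟩, rfl, fun x => ?_⟩
  have h : REV x = false := by
    rw [Bool.eq_false_iff, ne_eq, REV_eq_true_iff]
    exact fun h => ho h.1
  simpa [h, QuantumQueryAlgorithm.answerProb] using hε

end QuantumBound

/-! ### Comparing even rotations of two circular words with two pointers -/

section TwoPointers

theorem Function.Periodic.apply_add_nat_mul {α : Type*} {f : ℕ → α} {n : ℕ}
    (h : Function.Periodic f n) (t m : ℕ) : f (t + m * n) = f t := by
  simpa using h.nat_mul m t

/-- The rotation of the sequence `A` that starts at `i`, ordered lexicographically. -/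
def seqRotation (A : ℕ → ℕ) (i : ℕ) : Lex (ℕ → ℕ) := toLex fun t => A (i + t)

theorem seqRotation_lt_seqRotation {A B : ℕ → ℕ} {i j k u : ℕ}
    (h : ∀ t < k, A (i + t) = B (j + t)) (hk : A (i + k) < B (j + k)) (hu : u ≤ k) :
    seqRotation A (i + u) < seqRotation B (j + u) := by
  refine ⟨k - u, fun t ht => ?_, ?_⟩
  · have := h (u + t) (by omega)
    simpa [seqRotation, add_assoc] using this
  · have : u + (k - u) = k := by omega
    simpa [seqRotation, add_assoc, this] using hk

/-- The sequence `B` is a nontrivial even rotation of the `n`-periodic sequence `A`. -/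
def HasEvenShift (A B : ℕ → ℕ) (n : ℕ) : Prop :=
  ∃ d, Even d ∧ 0 < d ∧ d < n ∧ ∀ t, A (d + t) = B t

/-- The invariant of the comparison of the rotation `i` of `A` with the rotation `j` of `B`, which
agree up to position `k`. In the first phase all smaller even rotations of one word exceed
some even rotation of the other word. In the second phase the words are equal, and all even
rotations before `max i j` other than `i` and `j` exceed some even rotation. -/
structure TwoPointerInv (A B : ℕ → ℕ) (n : ℕ) (f : Bool) (i j k : ℕ) : Prop where
  even_left : Even i
  even_right : Even j
  le : k ≤ n
  agree : ∀ t < k, A (i + t) = B (j + t)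
  left : f = false → ∀ i' < i, Even i' → ∃ j', Even j' ∧ seqRotation B j' < seqRotation A i'
  right : f = false → ∀ j' < j, Even j' → ∃ i', Even i' ∧ seqRotation A i' < seqRotation B j'
  eq : f = true → A = B
  ne : f = true → i ≠ j
  both : f = true → ∀ t < max i j, Even t → t ≠ i → t ≠ j →
    ∃ t', Even t' ∧ seqRotation A t' < seqRotation A t

namespace TwoPointerInv

variable {A B : ℕ → ℕ} {n : ℕ} {f : Bool} {i j k : ℕ}

theorem init : TwoPointerInv A B n false 0 0 0 := by
  constructor <;> simp

theorem advance (h : TwoPointerInv A B n f i j k) (hk : k < n) (hab : A (i + k) = B (j + k)) :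
    TwoPointerInv A B n f i j (k + 1) :=
  { h with
    le := hk
    agree := fun t ht => by
      rcases Nat.lt_succ_iff_lt_or_eq.1 ht with ht | rfl
      · exact h.agree t ht
      · exact hab }

theorem even_skip (k : ℕ) : Even (k + 2 - k % 2) := by
  rw [Nat.even_iff]
  omega

/-- For every `u ≤ k` the rotation `i + u` of `A` exceeds the rotation `j + u` of `B`, so `i` may
jump to the first even position after `i + k`, at distance `k + 2 - k % 2`. In the second phase `j`
moves on if the pointers would collide. -/
theorem skip_left (h : TwoPointerInv A B n f i j k) (hab : B (j + k) < A (i + k)) {j' : ℕ}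
    (hj' : j' = if f = true ∧ i + (k + 2 - k % 2) = j then j + 2 else j) :
    TwoPointerInv A B n f (i + (k + 2 - k % 2)) j' 0 := by
  have hlt : ∀ u ≤ k, seqRotation B (j + u) < seqRotation A (i + u) := fun u hu =>
    seqRotation_lt_seqRotation (fun t ht => (h.agree t ht).symm) hab hu
  have hi := h.even_left.add (even_skip k)
  have hstep : ∀ i' < i + (k + 2 - k % 2), i ≤ i' → Even i' →
      ∃ j', Even j' ∧ seqRotation B j' < seqRotation A i' := by
    intro i' h1 h2 h3
    have h4 : Even (i' - i) := (Nat.even_sub h2).2 (by simp [h3, h.even_left])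
    have h5 : i' - i ≤ k := by
      have := Nat.even_iff.1 h4
      omega
    refine ⟨j + (i' - i), h.even_right.add h4, ?_⟩
    have := hlt _ h5
    rwa [Nat.add_sub_cancel' h2] at this
  have hjj : Even j' := by
    rw [hj']; split_ifs
    · exact h.even_right.add (by decide)
    · exact h.even_right
  refine ⟨hi, hjj, Nat.zero_le _, by simp, fun hf i' h1 h2 => ?_, fun hf => ?_, h.eq,
    fun hf => ?_, fun hf t h1 h2 h3 h4 => ?_⟩
  · rcases lt_or_ge i' i with h3 | h3
    · exact h.left hf i' h3 h2
    · exact hstep i' h1 h3 h2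
  · rw [hj', if_neg (by simp [hf])]
    exact h.right hf
  · rw [hj']; split_ifs with h1
    · omega
    · exact fun h2 => h1 ⟨hf, h2⟩
  · have hAB := h.eq hf
    subst hAB
    rcases Nat.lt_or_ge t (i + (k + 2 - k % 2)) with h5 | h5
    · rcases lt_or_ge t i with h6 | h6
      · by_cases h7 : t = j
        · exfalso
          rw [hj'] at h4
          split_ifs at h4 <;> omega
        · exact h.both hf t (by omega) h2 h6.ne h7
      · exact hstep t h5 h6 h2
    · have h6 : t ≠ j := by
        rintro rfl
        rw [hj'] at h4
        split_ifs at h4 with h7 <;> omega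
      refine h.both hf t ?_ h2 (by omega) h6
      rw [hj'] at h1
      rw [Nat.even_iff] at h2 hjj hi
      have := Nat.even_iff.1 h.even_right
      split_ifs at h1 with h7 <;> omega

theorem skip_right (h : TwoPointerInv A B n f i j k) (hab : A (i + k) < B (j + k)) {j' : ℕ}
    (hj' : j' = if f = true ∧ i = j + (k + 2 - k % 2) then j + (k + 2 - k % 2) + 2
      else j + (k + 2 - k % 2)) :
    TwoPointerInv A B n f i j' 0 := by
  have hlt : ∀ u ≤ k, seqRotation A (i + u) < seqRotation B (j + u) := fun u hu =>
    seqRotation_lt_seqRotation h.agree hab hu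
  have hj := h.even_right.add (even_skip k)
  have hstep : ∀ j' < j + (k + 2 - k % 2), j ≤ j' → Even j' →
      ∃ i', Even i' ∧ seqRotation A i' < seqRotation B j' := by
    intro j' h1 h2 h3
    have h4 : Even (j' - j) := (Nat.even_sub h2).2 (by simp [h3, h.even_right])
    have h5 : j' - j ≤ k := by
      have := Nat.even_iff.1 h4
      omega
    refine ⟨i + (j' - j), h.even_left.add h4, ?_⟩
    have := hlt _ h5
    rwa [Nat.add_sub_cancel' h2] at this
  have hjj : Even j' := by
    rw [hj']; split_ifs
    · exact hj.add (by decide)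
    · exact hj
  refine ⟨h.even_left, hjj, Nat.zero_le _, by simp, h.left, fun hf t h1 h2 => ?_, h.eq,
    fun hf => ?_, fun hf t h1 h2 h3 h4 => ?_⟩
  · rw [hj', if_neg (by simp [hf])] at h1
    rcases lt_or_ge t j with h3 | h3
    · exact h.right hf t h3 h2
    · exact hstep t h1 h3 h2
  · rw [hj']; split_ifs with h1
    · omega
    · exact fun h2 => h1 ⟨hf, h2⟩
  · have hAB := h.eq hf
    subst hAB
    rcases Nat.lt_or_ge t (j + (k + 2 - k % 2)) with h5 | h5
    · rcases lt_or_ge t j with h6 | h6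
      · exact h.both hf t (by omega) h2 h3 h6.ne
      · exact hstep t h5 h6 h2
    · refine h.both hf t ?_ h2 h3 (by omega)
      rw [Nat.even_iff] at h2 hjj hj
      rw [hj'] at h1 h4
      split_ifs at h1 h4 with h7 <;> omega

/-- A full match at equal pointers only shows `A = B`, the excluded shift `0`. The second phase
inherits from the first that all even rotations before `i` exceed some even rotation. -/
theorem switch (h : TwoPointerInv A B n f i i n) (hn : 0 < n) (hA : Function.Periodic A n)
    (hB : Function.Periodic B n) : f = false ∧ TwoPointerInv A B n true i (i + 2) 0 := by
  have hf : f = false := by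
    rcases hf : f
    · rfl
    · exact absurd rfl (h.ne hf)
  have hAB : A = B := by
    funext t
    have h1 : ∀ t, A (i + t) = B (i + t) := fun t => by
      have h2 := h.agree (t % n) (Nat.mod_lt _ hn)
      have h3 : i + t = (i + t % n) + (t / n) * n := by
        have := Nat.mod_add_div t n
        rw [mul_comm] at this
        omega
      rw [h3, hA.apply_add_nat_mul, hB.apply_add_nat_mul, h2]
    have h2 := h1 (t + i * n - i)
    have h3 : i + (t + i * n - i) = t + i * n := by
      have := Nat.le_mul_of_pos_right i hn
      omega
    rwa [h3, hA.apply_add_nat_mul, hB.apply_add_nat_mul] at h2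
  refine ⟨hf, h.even_left, h.even_left.add (by decide), Nat.zero_le _, by simp, by simp, by simp,
    fun _ => hAB, fun _ => by omega, fun _ t h1 h2 h3 h4 => ?_⟩
  subst hAB
  have hi := Nat.even_iff.1 h.even_left
  have ht := Nat.even_iff.1 h2
  exact h.left hf t (by omega) h2

theorem hasEvenShift (h : TwoPointerInv A B n f i j n) (hn : Even n)
    (hA : Function.Periodic A n) (hB : Function.Periodic B n) (hij : i ≠ j) (hi : i < n)
    (hj : j < n) : HasEvenShift A B n := by
  have hin := Nat.even_iff.1 h.even_left
  have hjn := Nat.even_iff.1 h.even_right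
  have hnn := Nat.even_iff.1 hn
  have h1 : ∀ t, A (i + t) = B (j + t) := fun t => by
    have h2 := h.agree (t % n) (Nat.mod_lt _ (by omega))
    have h3 : ∀ u, u + t = (u + t % n) + (t / n) * n := fun u => by
      have := Nat.mod_add_div t n
      rw [mul_comm] at this
      omega
    rw [h3 i, h3 j, hA.apply_add_nat_mul, hB.apply_add_nat_mul, h2]
  have h4 : ∀ t, A (i + n - j + t) = B t := fun t => by
    have h5 := h1 (n - j + t)
    rw [show j + (n - j + t) = t + n by omega, hB,
      show i + (n - j + t) = i + n - j + t by omega] at h5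
    exact h5
  rcases lt_or_ge (i + n - j) n with h5 | h5
  · exact ⟨i + n - j, by rw [Nat.even_iff]; omega, by omega, h5, h4⟩
  · refine ⟨i - j, by rw [Nat.even_iff]; omega, by omega, by omega, fun t => ?_⟩
    rw [← h4, show i + n - j + t = i - j + t + n by omega, hA]

/-- A shift would identify the even rotations of both words, so a least even rotation `m` of `A`
could not have been discarded in either word. In the second phase `m` and `(d + m) % n` are two
distinct least rotations, hence the pointers themselves, yet one pointer has passed `n`. -/
theorem not_hasEvenShift (h : TwoPointerInv A B n f i j k) (hn : Even n) (hn0 : 0 < n)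
    (hA : Function.Periodic A n) (hij : n ≤ i ∨ n ≤ j) :
    ¬ HasEvenShift A B n := by
  rintro ⟨d, hd, hd0, hdn, hAB⟩
  have hnn := Nat.even_iff.1 hn
  have hrot : ∀ t, seqRotation B t = seqRotation A (d + t) := fun t => by
    simp only [seqRotation, add_assoc, hAB]
  have hmod : ∀ t, seqRotation A (t % n) = seqRotation A t := fun t => by
    unfold seqRotation
    congr 1
    funext u
    have : t + u = t % n + u + (t / n) * n := by
      have := Nat.mod_add_div t n
      rw [mul_comm] at this
      omega
    rw [this, hA.apply_add_nat_mul]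
  have hmod_even : ∀ t, Even t → Even (t % n) := fun t ht => by
    rw [Nat.even_iff] at *
    rw [Nat.mod_mod_of_dvd _ (Nat.dvd_of_mod_eq_zero hnn)]
    exact ht
  obtain ⟨m, hm, hmin⟩ : ∃ m ∈ (Finset.range n).filter (fun m => Even m),
      ∀ t ∈ (Finset.range n).filter (fun t => Even t), seqRotation A m ≤ seqRotation A t :=
    Finset.exists_min_image _ _ ⟨0, by simp [hn0]⟩
  simp only [Finset.mem_filter, Finset.mem_range] at hm hmin
  have hmin' : ∀ t, Even t → ¬ seqRotation A t < seqRotation A m := fun t ht => by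
    rw [← hmod]
    exact not_lt.2 (hmin _ ⟨Nat.mod_lt _ hn0, hmod_even t ht⟩)
  rcases hf : f
  · rcases hij with hi | hj
    · obtain ⟨j', h1, h2⟩ := h.left hf m (by omega) hm.2
      rw [hrot] at h2
      exact hmin' _ (hd.add h1) h2
    · have h3 : Even ((n - d + m) % n) := hmod_even _ (by
        have := Nat.even_iff.1 hd
        have := Nat.even_iff.1 hm.2
        rw [Nat.even_iff]; omega)
      obtain ⟨i', h1, h2⟩ := h.right hf ((n - d + m) % n)
        (by have := Nat.mod_lt (n - d + m) hn0; omega) h3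
      have h4 : seqRotation B ((n - d + m) % n) = seqRotation A m := by
        rw [hrot, ← hmod, Nat.add_mod_mod, show d + (n - d + m) = m + n by omega,
          Nat.add_mod_right, hmod]
      rw [h4] at h2
      exact hmin' _ h1 h2
  · have hBA := h.eq hf
    subst hBA
    have h1 : seqRotation A ((d + m) % n) = seqRotation A m := by rw [hmod, ← hrot]
    have h2 : (d + m) % n ≠ m := by
      rcases lt_or_ge (d + m) n with h3 | h3
      · rw [Nat.mod_eq_of_lt h3]; omega
      · rw [Nat.mod_eq_sub_mod h3, Nat.mod_eq_of_lt (by omega)]; omega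
    have h3 : (d + m) % n < n := Nat.mod_lt _ hn0
    have h4 : ∀ t < n, Even t → seqRotation A t = seqRotation A m → t = i ∨ t = j := by
      intro t h5 h6 h7
      by_contra! h8
      obtain ⟨t', h9, h10⟩ := h.both hf t (by omega) h6 h8.1 h8.2
      rw [h7] at h10
      exact hmin' _ h9 h10
    have h5 := h4 m hm.1 hm.2 rfl
    have h6 := h4 _ h3 (hmod_even _ (hd.add hm.2)) h1
    omega

end TwoPointerInv

end TwoPointers

/-! ### A random access machine for `REV` -/

namespace RAM

variable {n q : ℕ}

/-- A configuration in which the first registers are stored in a list and all others hold `0`. -/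
structure ListConfig : Type where
  pc : ℕ
  regs : List ℕ
  queries : ℕ
  answer : Option Bool

namespace ListConfig

/-- The machine configuration that is described by a list. -/
def toConfig (c : ListConfig) : Config := ⟨c.pc, fun r => c.regs.getD r 0, c.queries, c.answer⟩

/-- Execution of one instruction without indirect access. -/
def exec (x : Fin n → Fin q) (c : ListConfig) : Instr → ListConfig
  | .const i a => { c with pc := c.pc + 1, regs := c.regs.set i a }
  | .add i j k =>
      { c with pc := c.pc + 1, regs := c.regs.set i (c.regs.getD j 0 + c.regs.getD k 0) }
  | .sub i j k =>
      { c with pc := c.pc + 1, regs := c.regs.set i (c.regs.getD j 0 - c.regs.getD k 0) }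
  -- Junk values for indirect access; `Instr.WritesBelow` rules these instructions out.
  | .load _ _ => c
  | .store _ _ => c
  | .query i j =>
      { c with
        pc := c.pc + 1
        regs := c.regs.set i (symbolAt x (c.regs.getD j 0))
        queries := c.queries + 1 }
  | .jumpPos j m => { c with pc := if 0 < c.regs.getD j 0 then m else c.pc + 1 }
  | .halt b => { c with answer := some b }

/-- One step of a program without indirect access. -/
def step (P : Program) (x : Fin n → Fin q) (c : ListConfig) : ListConfig :=
  match c.answer, P[c.pc]? with
  | none, some I => c.exec x I
  | _, _ => c

end ListConfig

/-- The instruction has no indirect access and writes only to registers below `m`. -/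
def Instr.WritesBelow (m : ℕ) : Instr → Bool
  | .const i _ => i < m
  | .add i _ _ => i < m
  | .sub i _ _ => i < m
  | .load _ _ => false
  | .store _ _ => false
  | .query i _ => i < m
  | .jumpPos _ _ => true
  | .halt _ => true

/-- The constants in the instruction are at most `m`. -/
def Instr.ConstLe (m : ℕ) : Instr → Bool
  | .const _ a => a ≤ m
  | _ => true

theorem getElem?_getD_set (l : List ℕ) {i : ℕ} (hi : i < l.length) (a : ℕ) :
    (fun r => (l.set i a)[r]?.getD 0) = Function.update (fun r => l[r]?.getD 0) i a := by
  funext r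
  by_cases h : r = i
  · subst h
    simp [hi]
  · simp [Function.update_of_ne h, List.getElem?_set_ne (Ne.symm h)]

/-- On explicit lists of registers execution reduces by computation, so straight-line blocks of the
program are verified by `rfl` and transferred to the machine. -/
theorem toConfig_step {P : Program} {m : ℕ} (hP : ∀ I ∈ P, I.WritesBelow m = true)
    (x : Fin n → Fin q) (c : ListConfig) (hc : c.regs.length = m) :
    (c.step P x).toConfig = step P x c.toConfig ∧ (c.step P x).regs.length = m := by
  obtain ⟨pc, l, qs, ans⟩ := c
  simp only at hc
  rcases ans with _ | b
  · rcases hI : P[pc]? with _ | I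
    · simp [ListConfig.step, step, ListConfig.toConfig, hI, hc]
    · have hw := hP I (List.mem_of_getElem? hI)
      cases I <;>
        simp_all [ListConfig.step, step, ListConfig.toConfig, ListConfig.exec, exec,
          Instr.WritesBelow, getElem?_getD_set]
  · simp [ListConfig.step, step, ListConfig.toConfig, hc]

theorem toConfig_iterate_step {P : Program} {m : ℕ} (hP : ∀ I ∈ P, I.WritesBelow m = true)
    (x : Fin n → Fin q) (c : ListConfig) (hc : c.regs.length = m) (t : ℕ) :
    ((ListConfig.step P x)^[t] c).toConfig = (step P x)^[t] c.toConfig := by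
  induction t generalizing c with
  | zero => rfl
  | succ t ih =>
    obtain ⟨h1, h2⟩ := toConfig_step hP x c hc
    rw [Function.iterate_succ_apply, Function.iterate_succ_apply, ← h1, ih _ h2]

theorem symbolAt_le (x : Fin n → Fin q) (a : ℕ) : symbolAt x a ≤ q := by
  unfold symbolAt
  split_ifs
  · exact (Fin.is_lt _).le
  · exact Nat.zero_le _

theorem reg_step_le {P : Program} {x : Fin n → Fin q} {c : Config} {M : ℕ}
    (hP : ∀ I ∈ P, I.ConstLe M = true) (hq : q ≤ M) (hc : ∀ r, c.reg r ≤ M) (r : ℕ) :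
    (step P x c).reg r ≤ 2 * M := by
  have hup : ∀ i v, v ≤ 2 * M → Function.update c.reg i v r ≤ 2 * M := fun i v hv => by
    rw [Function.update_apply]
    split_ifs
    · exact hv
    · have := hc r; omega
  have hr : c.reg r ≤ 2 * M := by have := hc r; omega
  unfold step
  split
  · rename_i I _ hI
    have hw := hP I (List.mem_of_getElem? hI)
    cases I with
    | const i a => exact hup _ _ (by simp [Instr.ConstLe] at hw; omega)
    | add i j k => exact hup _ _ (by have := hc j; have := hc k; omega)
    | sub i j k => exact hup _ _ (by have := hc j; omega)
    | load i j => exact hup _ _ (by have := hc (c.reg j); omega)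
    | store i j => exact hup _ _ (by have := hc j; omega)
    | query i j => exact hup _ _ (by have := symbolAt_le x (c.reg j); omega)
    | jumpPos j m => exact hr
    | halt b => exact hr
  · exact hr

/-- A step at most doubles the largest register. Within a block of bounded length this crude bound
costs only a constant number of bits, so intermediate values need no tracking. -/
theorem reg_iterate_step_le {P : Program} {x : Fin n → Fin q} {c : Config} {M : ℕ}
    (hP : ∀ I ∈ P, I.ConstLe M = true) (hq : q ≤ M) (hc : ∀ r, c.reg r ≤ M) (t r : ℕ) :
    ((step P x)^[t] c).reg r ≤ 2 ^ t * M := by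
  induction t generalizing r with
  | zero => simpa using hc r
  | succ t ih =>
    rw [Function.iterate_succ_apply', pow_succ', mul_assoc]
    have hM : M ≤ 2 ^ t * M := Nat.le_mul_of_pos_left _ (by positivity)
    refine reg_step_le (fun I hI => ?_) (hq.trans hM) ih r
    have := hP I hI
    cases I <;> simp_all [Instr.ConstLe]
    omega

theorem queries_step_le (P : Program) (x : Fin n → Fin q) (c : Config) :
    (step P x c).queries ≤ c.queries + 1 := by
  unfold step
  split
  · rename_i I _ _
    cases I <;> simp [exec]
  · omega

theorem queries_iterate_step_le (P : Program) (x : Fin n → Fin q) (c : Config) (t : ℕ) :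
    ((step P x)^[t] c).queries ≤ c.queries + t := by
  induction t with
  | zero => simp
  | succ t ih =>
    rw [Function.iterate_succ_apply']
    have := queries_step_le P x ((step P x)^[t] c)
    omega

/-- The program passes from `c` to `c'` in at most `T` steps. -/
def Runs (P : Program) (x : Fin n → Fin q) (T : ℕ) (c c' : ListConfig) : Prop :=
  ∃ t ≤ T, (ListConfig.step P x)^[t] c = c'

namespace Runs

variable {P : Program} {x : Fin n → Fin q} {T T' : ℕ} {c c' c'' : ListConfig}

theorem trans (h : Runs P x T c c') (h' : Runs P x T' c' c'') : Runs P x (T + T') c c'' := by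
  obtain ⟨t, ht, rfl⟩ := h
  obtain ⟨t', ht', rfl⟩ := h'
  exact ⟨t' + t, by omega, Function.iterate_add_apply _ _ _ _⟩

theorem mono (h : Runs P x T c c') (hT : T ≤ T') : Runs P x T' c c' := by
  obtain ⟨t, ht, h⟩ := h
  exact ⟨t, by omega, h⟩

theorem jump {pc j m qs : ℕ} {l : List ℕ} (hI : P[pc]? = some (.jumpPos j m))
    (hj : 0 < l.getD j 0) : Runs P x 1 ⟨pc, l, qs, none⟩ ⟨m, l, qs, none⟩ :=
  ⟨1, le_rfl, by simp only [Function.iterate_one, ListConfig.step, hI, ListConfig.exec, if_pos hj]⟩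

theorem noJump {pc j m qs : ℕ} {l : List ℕ} (hI : P[pc]? = some (.jumpPos j m))
    (hj : l.getD j 0 = 0) : Runs P x 1 ⟨pc, l, qs, none⟩ ⟨pc + 1, l, qs, none⟩ :=
  ⟨1, le_rfl, by
    simp only [Function.iterate_one, ListConfig.step, hI, ListConfig.exec, hj, lt_irrefl, if_false]⟩

end Runs

/-- The program: an even length test, then a search with two pointers for equal even rotations of
the word (pointer in `X₁`) and of its reverse (pointer in `X₂`). -/
def revProgram : Program :=
  -- `X₀ = n`, `X₁ = i`, `X₂ = j`, `X₃ = k`, `X₄ = k % 2`, `X₅` is the phase, `X₆ = 1`, `X₇ = 2`;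
  -- `X₈` and `X₉` hold the compared symbols and `X₁₀` is scratch. `X₃` is still `0`, so the third
  -- instruction copies `n`; `.jumpPos 6 m` is an unconditional jump.
  [.const 6 1, .const 7 2, .add 10 0 3,
    .jumpPos 10 5, .jumpPos 6 10, .sub 10 10 6, .jumpPos 10 8, .halt false, .sub 10 10 6,
    .jumpPos 6 3,
    .sub 10 0 1, .jumpPos 10 13, .halt false,
    .sub 10 0 2, .jumpPos 10 16, .halt false,
    .sub 10 0 3, .jumpPos 10 29,
    .sub 10 1 2, .jumpPos 10 23, .sub 10 2 1, .jumpPos 10 23, .jumpPos 6 24, .halt true,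
    .const 5 1, .add 2 2 7, .const 3 0, .const 4 0, .jumpPos 6 10,
    .add 8 1 3, .add 9 8 6, .sub 10 9 0, .jumpPos 10 34, .jumpPos 6 35, .sub 8 8 0, .query 8 8,
    .add 9 2 3, .add 9 9 6, .sub 10 9 0, .jumpPos 10 41, .jumpPos 6 42, .sub 9 9 0, .sub 9 0 9,
    .query 9 9,
    .sub 10 8 9, .jumpPos 10 51, .sub 10 9 8, .jumpPos 10 55,
    .add 3 3 6, .sub 4 6 4, .jumpPos 6 10,
    .add 10 3 7, .sub 10 10 4, .add 1 1 10, .jumpPos 6 58,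
    .add 10 3 7, .sub 10 10 4, .add 2 2 10,
    .const 3 0, .const 4 0, .jumpPos 5 62, .jumpPos 6 10,
    .sub 10 1 2, .jumpPos 10 10, .sub 10 2 1, .jumpPos 10 10, .add 2 2 7, .jumpPos 6 10]

theorem revProgram_writesBelow : ∀ I ∈ revProgram, I.WritesBelow 11 = true :=
  List.all_eq_true.1 rfl

theorem revProgram_constLe {M : ℕ} (hM : 2 ≤ M) : ∀ I ∈ revProgram, I.ConstLe M = true := by
  simp only [revProgram, List.forall_mem_cons, Instr.ConstLe, decide_eq_true_eq]
  simp
  omega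

/-! ### Fetching the two symbols to be compared -/

section Blocks

variable [NeZero n] (x : Fin n → Fin q)

/-- The word as an `n`-periodic sequence of numbers. -/
def forwardSeq (t : ℕ) : ℕ := circ x t

/-- The reverse of the word as an `n`-periodic sequence of numbers. -/
def backwardSeq (t : ℕ) : ℕ := circ x (-1 - t)

theorem symbolAt_of_emod {a : ℕ} {i : ℤ} (ha : a < n) (h : i % n = a) :
    symbolAt x a = circ x i := by
  rw [symbolAt, dif_pos ha, circ_eq_of_lt x ha h]

theorem runs_compare {i j k e f a b c qs : ℕ} (hi : i < n) (hj : j < n) (hk : k < n) :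
    Runs revProgram x 15 ⟨29, [n, i, j, k, e, f, 1, 2, a, b, c], qs, none⟩
      ⟨44, [n, i, j, k, e, f, 1, 2, forwardSeq x (i + k), backwardSeq x (j + k), j + k + 1 - n],
        qs + 2, none⟩ := by
  obtain ⟨a', ha', hrun⟩ : ∃ a', symbolAt x a' = forwardSeq x (i + k) ∧
      Runs revProgram x 6 ⟨29, [n, i, j, k, e, f, 1, 2, a, b, c], qs, none⟩
        ⟨35, [n, i, j, k, e, f, 1, 2, a', i + k + 1, i + k + 1 - n], qs, none⟩ := by
    have h1 : Runs revProgram x 3 ⟨29, [n, i, j, k, e, f, 1, 2, a, b, c], qs, none⟩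
        ⟨32, [n, i, j, k, e, f, 1, 2, i + k, i + k + 1, i + k + 1 - n], qs, none⟩ :=
      ⟨3, le_rfl, rfl⟩
    -- Since `i, k < n`, one subtraction of `n` reduces the address. The jump tests `i + k + 1 - n >
    -- 0`, as only strict positivity can be tested.
    by_cases h : n ≤ i + k
    · refine ⟨i + k - n, symbolAt_of_emod x (by omega) ?_,
        (h1.trans ((Runs.jump rfl ?_).trans ⟨1, le_rfl, rfl⟩)).mono (by norm_num)⟩
      · push_cast [Nat.cast_sub h]
        rw [← Int.sub_emod_right, Int.emod_eq_of_lt] <;> omega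
      · show 0 < i + k + 1 - n
        omega
    · refine ⟨i + k, symbolAt_of_emod x (by omega) ?_,
        (h1.trans ((Runs.noJump rfl ?_).trans (Runs.jump rfl (by exact Nat.one_pos)))).mono (by norm_num)⟩
      · rw [Int.emod_eq_of_lt] <;> omega
      · show i + k + 1 - n = 0
        omega
  obtain ⟨b', hb', hrun'⟩ : ∃ b', symbolAt x b' = backwardSeq x (j + k) ∧
      Runs revProgram x 7
        ⟨36, [n, i, j, k, e, f, 1, 2, forwardSeq x (i + k), i + k + 1, i + k + 1 - n], qs + 1, none⟩
        ⟨43, [n, i, j, k, e, f, 1, 2, forwardSeq x (i + k), b', j + k + 1 - n], qs + 1, none⟩ := by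
    have h1 : Runs revProgram x 3
        ⟨36, [n, i, j, k, e, f, 1, 2, forwardSeq x (i + k), i + k + 1, i + k + 1 - n], qs + 1, none⟩
        ⟨39, [n, i, j, k, e, f, 1, 2, forwardSeq x (i + k), j + k + 1, j + k + 1 - n], qs + 1,
          none⟩ :=
      ⟨3, le_rfl, rfl⟩
    by_cases h : n ≤ j + k
    · refine ⟨n - (j + k + 1 - n), symbolAt_of_emod x (by omega) ?_,
        (h1.trans ((Runs.jump rfl ?_).trans ⟨2, le_rfl, rfl⟩)).mono (by norm_num)⟩
      · rw [← Int.add_mul_emod_self_right _ 2, Int.emod_eq_of_lt] <;> push_cast <;> omega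
      · show 0 < j + k + 1 - n
        omega
    · refine ⟨n - (j + k + 1), symbolAt_of_emod x (by omega) ?_,
        (h1.trans ((Runs.noJump rfl ?_).trans ((Runs.jump rfl (by exact Nat.one_pos)).trans
          ⟨1, le_rfl, rfl⟩))).mono (by norm_num)⟩
      · rw [← Int.add_emod_right, Int.emod_eq_of_lt] <;> push_cast <;> omega
      · show j + k + 1 - n = 0
        omega
  have h2 : Runs revProgram x 1 ⟨35, [n, i, j, k, e, f, 1, 2, a', i + k + 1, i + k + 1 - n], qs, none⟩
      ⟨36, [n, i, j, k, e, f, 1, 2, forwardSeq x (i + k), i + k + 1, i + k + 1 - n], qs + 1,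
        none⟩ := by
    rw [← ha']
    exact ⟨1, le_rfl, rfl⟩
  have h3 : Runs revProgram x 1
      ⟨43, [n, i, j, k, e, f, 1, 2, forwardSeq x (i + k), b', j + k + 1 - n], qs + 1, none⟩
      ⟨44, [n, i, j, k, e, f, 1, 2, forwardSeq x (i + k), backwardSeq x (j + k), j + k + 1 - n],
        qs + 2, none⟩ := by
    rw [← hb']
    exact ⟨1, le_rfl, rfl⟩
  exact hrun.trans (h2.trans (hrun'.trans h3))

end Blocks

end RAM

namespace RAM

/-! ### One iteration of the program -/

section Iteration

variable {n q : ℕ} (x : Fin n → Fin q)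

theorem runs_head {i j k e f a b c qs : ℕ} (hi : i < n) (hj : j < n) :
    Runs revProgram x 5 ⟨10, [n, i, j, k, e, f, 1, 2, a, b, c], qs, none⟩
      ⟨17, [n, i, j, k, e, f, 1, 2, a, b, n - k], qs, none⟩ := by
  have h1 : Runs revProgram x 1 ⟨10, [n, i, j, k, e, f, 1, 2, a, b, c], qs, none⟩
      ⟨11, [n, i, j, k, e, f, 1, 2, a, b, n - i], qs, none⟩ := ⟨1, le_rfl, rfl⟩
  have h2 : Runs revProgram x 1 ⟨13, [n, i, j, k, e, f, 1, 2, a, b, n - i], qs, none⟩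
      ⟨14, [n, i, j, k, e, f, 1, 2, a, b, n - j], qs, none⟩ := ⟨1, le_rfl, rfl⟩
  exact h1.trans ((Runs.jump rfl (by exact Nat.sub_pos_of_lt hi)).trans
    (h2.trans ((Runs.jump rfl (by exact Nat.sub_pos_of_lt hj)).trans ⟨1, le_rfl, rfl⟩)))

theorem runs_exit {i j k e f a b c qs : ℕ} (h : n ≤ i ∨ n ≤ j) :
    ∃ c', c'.answer = some false ∧
      Runs revProgram x 5 ⟨10, [n, i, j, k, e, f, 1, 2, a, b, c], qs, none⟩ c' := by
  have h1 : Runs revProgram x 1 ⟨10, [n, i, j, k, e, f, 1, 2, a, b, c], qs, none⟩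
      ⟨11, [n, i, j, k, e, f, 1, 2, a, b, n - i], qs, none⟩ := ⟨1, le_rfl, rfl⟩
  have h2 : Runs revProgram x 1 ⟨13, [n, i, j, k, e, f, 1, 2, a, b, n - i], qs, none⟩
      ⟨14, [n, i, j, k, e, f, 1, 2, a, b, n - j], qs, none⟩ := ⟨1, le_rfl, rfl⟩
  by_cases hi : n ≤ i
  · exact ⟨_, rfl, (h1.trans ((Runs.noJump rfl (by exact Nat.sub_eq_zero_of_le hi)).trans
      ⟨1, le_rfl, rfl⟩)).mono (by norm_num)⟩
  · exact ⟨_, rfl, h1.trans ((Runs.jump rfl (by exact Nat.sub_pos_of_lt (not_le.1 hi))).trans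
      (h2.trans ((Runs.noJump rfl (by exact Nat.sub_eq_zero_of_le (h.resolve_left hi))).trans
        ⟨1, le_rfl, rfl⟩)))⟩

theorem runs_full_of_ne {i j e f a b c qs : ℕ} (hi : i < n) (hj : j < n) (h : i ≠ j) :
    ∃ c', c'.answer = some true ∧
      Runs revProgram x 11 ⟨10, [n, i, j, n, e, f, 1, 2, a, b, c], qs, none⟩ c' := by
  have h1 : Runs revProgram x 7 ⟨10, [n, i, j, n, e, f, 1, 2, a, b, c], qs, none⟩
      ⟨19, [n, i, j, n, e, f, 1, 2, a, b, i - j], qs, none⟩ :=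
    (runs_head x hi hj).trans
      ((Runs.noJump rfl (by exact Nat.sub_self n)).trans ⟨1, le_rfl, rfl⟩)
  have h2 : Runs revProgram x 1 ⟨20, [n, i, j, n, e, f, 1, 2, a, b, i - j], qs, none⟩
      ⟨21, [n, i, j, n, e, f, 1, 2, a, b, j - i], qs, none⟩ := ⟨1, le_rfl, rfl⟩
  rcases h.lt_or_gt with h | h
  · exact ⟨_, rfl, h1.trans ((Runs.noJump rfl (by exact Nat.sub_eq_zero_of_le h.le)).trans
      (h2.trans ((Runs.jump rfl (by exact Nat.sub_pos_of_lt h)).trans ⟨1, le_rfl, rfl⟩)))⟩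
  · exact ⟨_, rfl, (h1.trans ((Runs.jump rfl (by exact Nat.sub_pos_of_lt h)).trans
      ⟨1, le_rfl, rfl⟩)).mono (by norm_num)⟩

theorem runs_full_of_eq {i e f a b c qs : ℕ} (hi : i < n) :
    Runs revProgram x 16 ⟨10, [n, i, i, n, e, f, 1, 2, a, b, c], qs, none⟩
      ⟨10, [n, i, i + 2, 0, 0, 1, 1, 2, a, b, i - i], qs, none⟩ := by
  have h1 : Runs revProgram x 7 ⟨10, [n, i, i, n, e, f, 1, 2, a, b, c], qs, none⟩
      ⟨19, [n, i, i, n, e, f, 1, 2, a, b, i - i], qs, none⟩ :=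
    (runs_head x hi hi).trans
      ((Runs.noJump rfl (by exact Nat.sub_self n)).trans ⟨1, le_rfl, rfl⟩)
  have h2 : Runs revProgram x 1 ⟨20, [n, i, i, n, e, f, 1, 2, a, b, i - i], qs, none⟩
      ⟨21, [n, i, i, n, e, f, 1, 2, a, b, i - i], qs, none⟩ := ⟨1, le_rfl, rfl⟩
  have h3 : Runs revProgram x 6 ⟨22, [n, i, i, n, e, f, 1, 2, a, b, i - i], qs, none⟩
      ⟨10, [n, i, i + 2, 0, 0, 1, 1, 2, a, b, i - i], qs, none⟩ := ⟨6, le_rfl, rfl⟩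
  exact h1.trans ((Runs.noJump rfl (by exact Nat.sub_self i)).trans
      (h2.trans ((Runs.noJump rfl (by exact Nat.sub_self i)).trans h3)))

theorem runs_reset (f : Bool) {i j k e a b c qs M : ℕ} (hi : i ≤ M) (hj : j ≤ M) (hc : c ≤ M) :
    ∃ c' ≤ M, Runs revProgram x 9 ⟨58, [n, i, j, k, e, f.toNat, 1, 2, a, b, c], qs, none⟩
      ⟨10, [n, i, if f = true ∧ i = j then j + 2 else j, 0, 0, f.toNat, 1, 2, a, b, c'], qs,
        none⟩ := by
  cases f with
  | false => exact ⟨c, hc, 4, by norm_num, by simp only [Bool.false_eq_true, false_and, if_false]; rfl⟩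
  | true =>
    have h1 : Runs revProgram x 4 ⟨58, [n, i, j, k, e, true.toNat, 1, 2, a, b, c], qs, none⟩
        ⟨63, [n, i, j, 0, 0, true.toNat, 1, 2, a, b, i - j], qs, none⟩ := ⟨4, le_rfl, rfl⟩
    have h2 : Runs revProgram x 1 ⟨64, [n, i, j, 0, 0, true.toNat, 1, 2, a, b, i - j], qs, none⟩
        ⟨65, [n, i, j, 0, 0, true.toNat, 1, 2, a, b, j - i], qs, none⟩ := ⟨1, le_rfl, rfl⟩
    rcases lt_trichotomy i j with h | h | h
    · rw [if_neg (by omega)]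
      exact ⟨j - i, by omega, (h1.trans ((Runs.noJump rfl (by exact Nat.sub_eq_zero_of_le h.le)).trans
        (h2.trans (Runs.jump rfl (by exact Nat.sub_pos_of_lt h))))).mono (by norm_num)⟩
    · subst h
      rw [if_pos ⟨rfl, rfl⟩]
      have h3 : Runs revProgram x 2 ⟨66, [n, i, i, 0, 0, true.toNat, 1, 2, a, b, i - i], qs, none⟩
        ⟨10, [n, i, i + 2, 0, 0, true.toNat, 1, 2, a, b, i - i], qs, none⟩ := ⟨2, le_rfl, rfl⟩
      exact ⟨i - i, by omega, (h1.trans ((Runs.noJump rfl (by exact Nat.sub_self i)).trans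
        (h2.trans ((Runs.noJump rfl (by exact Nat.sub_self i)).trans h3)))).mono (by norm_num)⟩
    · rw [if_neg (by omega)]
      exact ⟨i - j, by omega, (h1.trans (Runs.jump rfl (by exact Nat.sub_pos_of_lt h))).mono
        (by norm_num)⟩

variable [NeZero n]

theorem forwardSeq_le (t : ℕ) : forwardSeq x t ≤ q := (Fin.is_lt _).le

theorem backwardSeq_le (t : ℕ) : backwardSeq x t ≤ q := (Fin.is_lt _).le

theorem runs_head_compare {i j k e f a b c qs : ℕ} (hi : i < n) (hj : j < n) (hk : k < n) :
    ∃ c', Runs revProgram x 22 ⟨10, [n, i, j, k, e, f, 1, 2, a, b, c], qs, none⟩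
      ⟨45, [n, i, j, k, e, f, 1, 2, forwardSeq x (i + k), backwardSeq x (j + k), c'],
        qs + 2, none⟩ ∧ c' = forwardSeq x (i + k) - backwardSeq x (j + k) :=
  ⟨_, (runs_head x hi hj).trans ((Runs.jump rfl (by exact Nat.sub_pos_of_lt hk)).trans
    ((runs_compare x hi hj hk).trans ⟨1, le_rfl, rfl⟩)), rfl⟩

theorem periodic_forwardSeq : Function.Periodic (forwardSeq x) n := fun t => by
  have := circ_periodic x t
  simp only [forwardSeq]
  push_cast
  rw [this]

theorem periodic_backwardSeq : Function.Periodic (backwardSeq x) n := fun t => by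
  have := circ_periodic x (-1 - (t + n : ℕ))
  simp only [backwardSeq]
  rw [← this]
  push_cast
  ring_nf

-- The potential `i + j + k + 4 * n * f` strictly increases: a match raises `k`, a skip moves a
-- pointer by more than the `k` that is lost, and the change of phase gains `4 * n` against a loss
-- of `n`.
open Classical in
theorem runs_iteration (hn : Even n) {f : Bool} {i j k a b c qs M : ℕ} (hM : 4 * n + q + 8 ≤ M)
    (h : TwoPointerInv (forwardSeq x) (backwardSeq x) n f i j k)
    (ha : a ≤ M) (hb : b ≤ M) :
    (∃ c', c'.answer = some (decide (HasEvenShift (forwardSeq x) (backwardSeq x) n)) ∧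
      Runs revProgram x 40 ⟨10, [n, i, j, k, k % 2, f.toNat, 1, 2, a, b, c], qs, none⟩ c') ∨
    ∃ f' i' j' k' a' b' c' qs', i' ≤ M ∧ j' ≤ M ∧ k' ≤ M ∧ a' ≤ M ∧ b' ≤ M ∧ c' ≤ M ∧
      i < n ∧ j < n ∧
      i + j + k + 4 * n * f.toNat < i' + j' + k' + 4 * n * f'.toNat ∧
      TwoPointerInv (forwardSeq x) (backwardSeq x) n f' i' j' k' ∧
      Runs revProgram x 40 ⟨10, [n, i, j, k, k % 2, f.toNat, 1, 2, a, b, c], qs, none⟩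
        ⟨10, [n, i', j', k', k' % 2, f'.toNat, 1, 2, a', b', c'], qs', none⟩ := by
  have hn0 : 0 < n := NeZero.pos n
  have hA := periodic_forwardSeq x
  have hB := periodic_backwardSeq x
  by_cases hij : n ≤ i ∨ n ≤ j
  · left
    rw [decide_eq_false (h.not_hasEvenShift hn hn0 hA hij)]
    obtain ⟨c', h1, h2⟩ := runs_exit x hij
    exact ⟨c', h1, h2.mono (by norm_num)⟩
  push Not at hij
  obtain ⟨hi, hj⟩ := hij
  rcases h.le.eq_or_lt with rfl | hk
  · by_cases hij : i = j
    · subst hij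
      obtain ⟨hf, h'⟩ := h.switch hn0 hA hB
      subst hf
      exact Or.inr ⟨true, i, i + 2, 0, a, b, i - i, qs, by omega, by omega, by omega, ha, hb,
        by omega, hi, hj, by simp; omega, h', (runs_full_of_eq x hi).mono (by norm_num)⟩
    · left
      rw [decide_eq_true (h.hasEvenShift hn hA hB hij hi hj)]
      obtain ⟨c', h1, h2⟩ := runs_full_of_ne x hi hj hij
      exact ⟨c', h1, h2.mono (by norm_num)⟩
  right
  obtain ⟨d, hd, hdv⟩ := runs_head_compare x (e := k % 2) (f := f.toNat) (a := a) (b := b)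
    (c := c) (qs := qs) hi hj hk
  have hav := forwardSeq_le x (i + k)
  have hbv := backwardSeq_le x (j + k)
  generalize hae : forwardSeq x (i + k) = α at *
  generalize hbe : backwardSeq x (j + k) = β at *
  rcases lt_trichotomy α β with hab | hab | hab
  · have h1 : Runs revProgram x 1 ⟨46, [n, i, j, k, k % 2, f.toNat, 1, 2, α, β, d], qs + 2, none⟩
        ⟨47, [n, i, j, k, k % 2, f.toNat, 1, 2, α, β, β - α], qs + 2, none⟩ := ⟨1, le_rfl, rfl⟩
    have h2 : Runs revProgram x 3
        ⟨55, [n, i, j, k, k % 2, f.toNat, 1, 2, α, β, β - α], qs + 2, none⟩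
        ⟨58, [n, i, j + (k + 2 - k % 2), k, k % 2, f.toNat, 1, 2, α, β, k + 2 - k % 2], qs + 2,
          none⟩ := ⟨3, le_rfl, rfl⟩
    obtain ⟨c', hc', h3⟩ := runs_reset x f (i := i) (j := j + (k + 2 - k % 2)) (k := k)
      (e := k % 2) (a := α) (b := β) (c := k + 2 - k % 2) (qs := qs + 2) (M := M) (by omega)
      (by omega) (by omega)
    refine ⟨f, i, _, 0, α, β, c', qs + 2, by omega, ?_, by omega, by omega, by omega, hc', hi, hj,
      ?_, h.skip_right (by rw [hae, hbe]; exact hab) rfl,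
      (hd.trans ((Runs.noJump rfl (by exact hdv ▸ Nat.sub_eq_zero_of_le hab.le)).trans (h1.trans
        ((Runs.jump rfl (by exact Nat.sub_pos_of_lt hab)).trans (h2.trans h3))))).mono
        (by norm_num)⟩
    · split_ifs <;> omega
    · split_ifs <;> omega
  · have h1 : Runs revProgram x 1 ⟨46, [n, i, j, k, k % 2, f.toNat, 1, 2, α, β, d], qs + 2, none⟩
        ⟨47, [n, i, j, k, k % 2, f.toNat, 1, 2, α, β, β - α], qs + 2, none⟩ := ⟨1, le_rfl, rfl⟩
    have h2 : Runs revProgram x 3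
        ⟨48, [n, i, j, k, k % 2, f.toNat, 1, 2, α, β, β - α], qs + 2, none⟩
        ⟨10, [n, i, j, k + 1, (k + 1) % 2, f.toNat, 1, 2, α, β, β - α], qs + 2, none⟩ := by
      rw [show (k + 1) % 2 = 1 - k % 2 by omega]
      exact ⟨3, le_rfl, rfl⟩
    exact ⟨f, i, j, k + 1, α, β, β - α, qs + 2, by omega, by omega, by omega, by omega, by omega,
      by omega, hi, hj, by omega, h.advance hk (by rw [hae, hbe]; exact hab),
      (hd.trans ((Runs.noJump rfl (by exact hdv ▸ Nat.sub_eq_zero_of_le hab.le)).trans (h1.trans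
        ((Runs.noJump rfl (by exact Nat.sub_eq_zero_of_le hab.ge)).trans h2)))).mono
        (by norm_num)⟩
  · have h2 : Runs revProgram x 4
        ⟨51, [n, i, j, k, k % 2, f.toNat, 1, 2, α, β, d], qs + 2, none⟩
        ⟨58, [n, i + (k + 2 - k % 2), j, k, k % 2, f.toNat, 1, 2, α, β, k + 2 - k % 2], qs + 2,
          none⟩ := ⟨4, le_rfl, rfl⟩
    obtain ⟨c', hc', h3⟩ := runs_reset x f (i := i + (k + 2 - k % 2)) (j := j) (k := k)
      (e := k % 2) (a := α) (b := β) (c := k + 2 - k % 2) (qs := qs + 2) (M := M) (by omega)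
      (by omega) (by omega)
    refine ⟨f, _, _, 0, α, β, c', qs + 2, by omega, ?_, by omega, by omega, by omega, hc', hi, hj,
      ?_, h.skip_left (by rw [hae, hbe]; exact hab) rfl,
      (hd.trans ((Runs.jump rfl (by exact hdv ▸ Nat.sub_pos_of_lt hab)).trans (h2.trans h3))).mono
        (by norm_num)⟩
    · split_ifs <;> omega
    · split_ifs <;> omega

end Iteration

end RAM

namespace RAM

/-! ### Correctness and running time of the program -/

section Correctness

variable {n q : ℕ} (x : Fin n → Fin q)

/-- The program passes from `c` to `c'` in at most `T` steps, and no register ever exceeds `B`. -/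
def BoundedRuns (P : Program) (x : Fin n → Fin q) (T B : ℕ) (c c' : ListConfig) : Prop :=
  ∃ t ≤ T, (ListConfig.step P x)^[t] c = c' ∧
    ∀ s ≤ t, ∀ r, ((ListConfig.step P x)^[s] c).toConfig.reg r ≤ B

theorem BoundedRuns.trans {P : Program} {x : Fin n → Fin q} {T T' B : ℕ} {c c' c'' : ListConfig}
    (h : BoundedRuns P x T B c c') (h' : BoundedRuns P x T' B c' c'') :
    BoundedRuns P x (T + T') B c c'' := by
  obtain ⟨t, ht, rfl, hB⟩ := h
  obtain ⟨t', ht', rfl, hB'⟩ := h'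
  refine ⟨t' + t, by omega, Function.iterate_add_apply _ _ _ _, fun s hs r => ?_⟩
  rcases le_total s t with h | h
  · exact hB s h r
  · obtain ⟨u, rfl⟩ := Nat.exists_eq_add_of_le' h
    rw [Function.iterate_add_apply]
    exact hB' u (by omega) r

theorem BoundedRuns.mono {P : Program} {x : Fin n → Fin q} {T T' B : ℕ} {c c' : ListConfig}
    (h : BoundedRuns P x T B c c') (hT : T ≤ T') : BoundedRuns P x T' B c c' := by
  obtain ⟨t, ht, h⟩ := h
  exact ⟨t, by omega, h⟩

theorem Runs.boundedRuns {x : Fin n → Fin q} {T M : ℕ} {c c' : ListConfig}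
    (h : Runs revProgram x T c c') (hq : q + 2 ≤ M) (hlen : c.regs.length = 11)
    (hc : ∀ a ∈ c.regs, a ≤ M) : BoundedRuns revProgram x T (2 ^ T * M) c c' := by
  obtain ⟨t, ht, h⟩ := h
  refine ⟨t, ht, h, fun s hs r => ?_⟩
  rw [toConfig_iterate_step revProgram_writesBelow x c hlen]
  refine (reg_iterate_step_le (revProgram_constLe (M := M) (by omega)) (by omega) (fun r => ?_)
    s r).trans (Nat.mul_le_mul_right _ (Nat.pow_le_pow_right (by norm_num) (hs.trans ht)))
  simp only [ListConfig.toConfig, List.getD]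
  rcases hr : c.regs[r]? with _ | v
  · exact Nat.zero_le _
  · exact hc v (List.mem_of_getElem? hr)

theorem runs_parity (M : ℕ) (hM : n + q + 2 ≤ M) (a : ℕ) (ha : a ≤ n) :
    (Odd a → ∃ c', c'.answer = some false ∧
      BoundedRuns revProgram x (5 * a + 5) (2 ^ 40 * M)
        ⟨3, [n, 0, 0, 0, 0, 0, 1, 2, 0, 0, a], 0, none⟩ c') ∧
    (Even a → BoundedRuns revProgram x (5 * a + 5) (2 ^ 40 * M)
        ⟨3, [n, 0, 0, 0, 0, 0, 1, 2, 0, 0, a], 0, none⟩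
        ⟨10, [n, 0, 0, 0, 0, 0, 1, 2, 0, 0, 0], 0, none⟩) := by
  have key : ∀ {a T : ℕ} {c' : ListConfig}, a ≤ n → T ≤ 40 →
      Runs revProgram x T ⟨3, [n, 0, 0, 0, 0, 0, 1, 2, 0, 0, a], 0, none⟩ c' →
      BoundedRuns revProgram x T (2 ^ 40 * M)
        ⟨3, [n, 0, 0, 0, 0, 0, 1, 2, 0, 0, a], 0, none⟩ c' := by
    intro a T c' ha hT h
    obtain ⟨t, ht, h1, h2⟩ := h.boundedRuns (M := M) (by omega) rfl (by simp; omega)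
    exact ⟨t, ht, h1, fun s hs r => (h2 s hs r).trans
      (Nat.mul_le_mul_right _ (Nat.pow_le_pow_right (by norm_num) hT))⟩
  induction a using Nat.strong_induction_on with
  | _ a ih =>
  match a, ih, ha with
  | 0, _, _ =>
    refine ⟨by simp, fun _ => (key (by omega) (by norm_num) ((Runs.noJump rfl rfl).trans
      (Runs.jump rfl (by exact Nat.one_pos)))).mono (by norm_num)⟩
  | 1, _, _ =>
    refine ⟨fun _ => ?_, by simp⟩
    have h1 : Runs revProgram x 4 ⟨3, [n, 0, 0, 0, 0, 0, 1, 2, 0, 0, 1], 0, none⟩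
        ⟨7, [n, 0, 0, 0, 0, 0, 1, 2, 0, 0, 0], 0, some false⟩ := ⟨4, le_rfl, rfl⟩
    exact ⟨_, rfl, (key (by omega) (by norm_num) h1).mono (by norm_num)⟩
  | a + 2, ih, ha =>
    have h1 : Runs revProgram x 5 ⟨3, [n, 0, 0, 0, 0, 0, 1, 2, 0, 0, a + 2], 0, none⟩
        ⟨3, [n, 0, 0, 0, 0, 0, 1, 2, 0, 0, a], 0, none⟩ := ⟨5, le_rfl, rfl⟩
    have h2 := key ha (by norm_num) h1
    obtain ⟨h3, h4⟩ := ih a (by omega) (by omega)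
    refine ⟨fun h => ?_, fun h => (h2.trans (h4 (by simpa [Nat.even_add] using h))).mono
      (by omega)⟩
    obtain ⟨c', hc', h5⟩ := h3 (by simpa [Nat.odd_add] using h)
    exact ⟨c', hc', (h2.trans h5).mono (by omega)⟩

variable [NeZero n]

-- While the loop continues, `i, j < n` and `k ≤ n`, so the potential stays below `8 * n` and `N`
-- bounds the remaining iterations. Each iteration starts with registers at most `M`, so the factor
-- `2 ^ 40` does not accumulate.
open Classical in
theorem runs_loop (hn : Even n) {M : ℕ} (hM : 4 * n + q + 8 ≤ M) (N : ℕ) {f : Bool}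
    {i j k a b c qs : ℕ} (h : TwoPointerInv (forwardSeq x) (backwardSeq x) n f i j k)
    (hi : i ≤ M) (hj : j ≤ M) (hk : k ≤ M) (ha : a ≤ M) (hb : b ≤ M) (hc : c ≤ M)
    (hN : 8 * n < i + j + k + 4 * n * f.toNat + N) :
    ∃ c', c'.answer = some (decide (HasEvenShift (forwardSeq x) (backwardSeq x) n)) ∧
      BoundedRuns revProgram x (40 * (N + 1)) (2 ^ 40 * M)
        ⟨10, [n, i, j, k, k % 2, f.toNat, 1, 2, a, b, c], qs, none⟩ c' := by
  have hreg : ∀ v ∈ [n, i, j, k, k % 2, f.toNat, 1, 2, a, b, c], v ≤ M := by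
    have hf := Bool.toNat_le f
    simp
    omega
  induction N generalizing f i j k a b c qs with
  | zero =>
    rcases runs_iteration x hn hM h (c := c) (qs := qs) ha hb with
      ⟨c', h1, h2⟩ | ⟨f', i', j', k', a', b', c', qs', -, -, -, -, -, -, h1, h2, -⟩
    · exact ⟨c', h1, (h2.boundedRuns (by omega) rfl hreg).mono (by norm_num)⟩
    · exfalso
      have := h.le
      have := Nat.mul_le_mul_left (4 * n) (Bool.toNat_le f)
      omega
  | succ N ih =>
    rcases runs_iteration x hn hM h (c := c) (qs := qs) ha hb with
      ⟨c', h1, h2⟩ | ⟨f', i', j', k', a', b', c', qs', hi', hj', hk', ha', hb', hc', -, -, hlt,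
        hinv, hrun⟩
    · exact ⟨c', h1, (h2.boundedRuns (by omega) rfl hreg).mono (by omega)⟩
    · have hreg' : ∀ v ∈ [n, i', j', k', k' % 2, f'.toNat, 1, 2, a', b', c'], v ≤ M := by
        have hf := Bool.toNat_le f'
        simp
        omega
      obtain ⟨c'', h3, h4⟩ := ih hinv hi' hj' hk' ha' hb' hc' (qs := qs') (by omega) hreg'
      exact ⟨c'', h3, ((hrun.boundedRuns (by omega) rfl hreg).trans h4).mono (by omega)⟩

theorem REV_eq_true_iff_hasEvenShift :
    REV x = true ↔ Even n ∧ HasEvenShift (forwardSeq x) (backwardSeq x) n := by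
  rw [REV_eq_true_iff]
  refine and_congr_right fun _ => exists_congr fun d => and_congr_right fun _ =>
    and_congr_right fun _ => and_congr_right fun _ => ⟨fun h t => ?_, fun h i => ?_⟩
  · have := h (-1 - t)
    simp only [forwardSeq, backwardSeq, ← this]
    push_cast
    ring_nf
  · have h1 := h ((-1 - i) % n).toNat
    simp only [forwardSeq, backwardSeq] at h1
    have h2 := Fin.val_injective h1
    have h3 : (((-1 - i) % n).toNat : ℤ) = (-1 - i) % n :=
      Int.toNat_of_nonneg (Int.emod_nonneg _ (by exact_mod_cast NeZero.ne n))
    push_cast at h2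
    rw [h3] at h2
    have h4 : (d - 1 - i : ℤ) % n = (d + (-1 - i) % n) % n := by
      rw [Int.add_emod_emod]
      ring_nf
    have h5 : i % n = (-1 - (-1 - i) % n) % n := by
      rw [Int.sub_emod_emod]
      ring_nf
    rw [circ_congr x h4, circ_congr x h5, h2]

open Classical in
theorem boundedRuns_revProgram {M : ℕ} (hM : 4 * n + q + 8 ≤ M) :
    ∃ c', c'.answer = some (REV x) ∧ BoundedRuns revProgram x (400 * n + 88) (2 ^ 40 * M)
      ⟨0, [n, 0, 0, 0, 0, 0, 0, 0, 0, 0, 0], 0, none⟩ c' := by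
  have h0 : BoundedRuns revProgram x 3 (2 ^ 40 * M)
      ⟨0, [n, 0, 0, 0, 0, 0, 0, 0, 0, 0, 0], 0, none⟩
      ⟨3, [n, 0, 0, 0, 0, 0, 1, 2, 0, 0, n], 0, none⟩ := by
    have h1 : Runs revProgram x 3 ⟨0, [n, 0, 0, 0, 0, 0, 0, 0, 0, 0, 0], 0, none⟩
        ⟨3, [n, 0, 0, 0, 0, 0, 1, 2, 0, 0, n + 0], 0, none⟩ := ⟨3, le_rfl, rfl⟩
    obtain ⟨t, ht, h2, h3⟩ := h1.boundedRuns (M := M) (by omega) rfl (by simp; omega)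
    exact ⟨t, ht, h2, fun s hs r => (h3 s hs r).trans
      (Nat.mul_le_mul_right _ (by norm_num))⟩
  obtain ⟨hodd, heven⟩ := runs_parity x M (by omega) n le_rfl
  by_cases hn : Even n
  · obtain ⟨c', h1, h2⟩ := runs_loop x hn hM (8 * n + 1) TwoPointerInv.init (a := 0) (b := 0)
      (c := 0) (qs := 0) (Nat.zero_le _) (Nat.zero_le _)
      (Nat.zero_le _) (Nat.zero_le _) (Nat.zero_le _) (Nat.zero_le _) (by simp)
    refine ⟨c', ?_, (h0.trans ((heven hn).trans h2)).mono (by omega)⟩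
    rw [h1]
    congr 1
    rw [Bool.eq_iff_iff, REV_eq_true_iff_hasEvenShift, decide_eq_true_iff]
    simp [hn]
  · obtain ⟨c', h1, h2⟩ := hodd (Nat.not_even_iff_odd.1 hn)
    refine ⟨c', ?_, (h0.trans h2).mono (by omega)⟩
    rw [h1, eq_comm, Option.some_inj, Bool.eq_false_iff, Ne, REV_eq_true_iff_hasEvenShift]
    exact fun h => hn h.1

theorem start_eq (n : ℕ) :
    start n = (⟨0, [n, 0, 0, 0, 0, 0, 0, 0, 0, 0, 0], 0, none⟩ : ListConfig).toConfig := by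
  simp only [start, ListConfig.toConfig, Config.mk.injEq, true_and, and_true]
  funext r
  rcases r with _ | r
  · simp
  · rw [Function.update_of_ne (Nat.succ_ne_zero r)]
    change 0 = (List.replicate 10 0).getD r 0
    simp only [List.getD, List.getElem?_replicate]
    split_ifs <;> rfl

theorem computesWithin_revProgram :
    ComputesWithin revProgram x (REV x) ((q + 488) * n) ((q + 488) * n)
      ((q + 488) * (Nat.log 2 n + 1)) := by
  have hn : 0 < n := NeZero.pos n
  obtain ⟨c', h1, t, ht, h2, h3⟩ := boundedRuns_revProgram x (M := 4 * n + q + 8) le_rfl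
  have hrun : ∀ s, run revProgram x s = ((ListConfig.step revProgram x)^[s]
      ⟨0, [n, 0, 0, 0, 0, 0, 0, 0, 0, 0, 0], 0, none⟩).toConfig := fun s => by
    rw [toConfig_iterate_step revProgram_writesBelow x _ rfl, run, start_eq]
  -- The constant is `488 = 400 + 88`, as `n ≥ 1` absorbs the additive term.
  have hT : t ≤ (q + 488) * n := ht.trans (by nlinarith [Nat.zero_le (q * n)])
  refine ⟨t, hT, ?_, ?_, fun s hs r => ?_⟩
  · rw [hrun, h2]
    exact h1
  · exact (queries_iterate_step_le _ _ _ _).trans (by simpa [start] using hT)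
  · rw [hrun]
    refine (h3 s hs r).trans_lt ?_
    have hlog : n < 2 ^ (Nat.log 2 n + 1) := Nat.lt_pow_succ_log_self (by norm_num) n
    have hq : q < 2 ^ q := Nat.lt_two_pow_self
    have h4 : 4 * n + q + 8 ≤ 16 * (2 ^ q * n) := by
      have h5 : q < 2 ^ q * n := hq.trans_le (Nat.le_mul_of_pos_right _ hn)
      have h6 : n ≤ 2 ^ q * n := Nat.le_mul_of_pos_left _ (by positivity)
      omega
    calc 2 ^ 40 * (4 * n + q + 8) ≤ 2 ^ (44 + q) * n := by
          rw [pow_add, show (2 : ℕ) ^ 44 = 2 ^ 40 * 16 by norm_num, mul_assoc, mul_assoc]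
          exact Nat.mul_le_mul_left _ h4
      _ < 2 ^ (44 + q) * 2 ^ (Nat.log 2 n + 1) := Nat.mul_lt_mul_of_pos_left hlog (by positivity)
      _ ≤ 2 ^ ((q + 488) * (Nat.log 2 n + 1)) := by
          rw [← pow_add]
          exact Nat.pow_le_pow_right (by norm_num)
            (by nlinarith [Nat.zero_le (q * Nat.log 2 n), Nat.zero_le (Nat.log 2 n)])

end Correctness

end RAM

theorem mainTheorem2 (q : ℕ) [NeZero q] :
    (∃ (P : RAM.Program) (C : ℕ), ∀ n : ℕ, 0 < n → ∀ x : Fin n → Fin q,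
      RAM.ComputesWithin P x (REV x) (C * n) (C * n) (C * (Nat.log 2 n + 1))) ∧
    (∃ C ε : ℝ, ε < 1 / 2 ∧ ∀ n : ℕ, 0 < n → ∃ A : QuantumQueryAlgorithm n q,
      (A.queries : ℝ) ≤ C * (Real.sqrt n * Real.log n ^ 2) ∧ A.ComputesWithError REV ε) := by
  refine ⟨⟨RAM.revProgram, q + 488, fun n hn x => ?_⟩,
    q * (21 + 2400 * HasAdv.eqCost q) / Real.log 2 ^ 2, 1 / 10, by norm_num, fun n hn => ?_⟩
  · have : NeZero n := ⟨hn.ne'⟩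
    exact RAM.computesWithin_revProgram x
  -- For `n = 1` the bound is `0` because `log 1 = 0`, so an algorithm without queries is needed;
  -- the odd length makes the answer constant.
  · rcases Nat.lt_or_ge n 2 with h | h
    · obtain rfl : n = 1 := by omega
      obtain ⟨A, h1, h2⟩ := exists_algorithm_REV_of_odd (n := 1) (q := q) one_pos (by decide)
        (ε := 1 / 10) (by norm_num)
      exact ⟨A, by simp [h1], h2⟩
    · exact exists_algorithm_REV h
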